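/- Let $A\in\mathbb R^{n\times n}$, $B^L\in\mathbb R^{n\times l}$, $B^R\in\mathbb R^{n\times r}$, $p\in[0,1]$, and consider the noise-free system $$x_{k+1}=Ax_k+B^Lu^L_k+B^Ru^R_k,\qquad k\ge 0,$$ where $x_0$ is a Gaussian random vector (its mean and its positive semi-definite covariance are arbitrary). The state is sent over a lossy channel: $\eta_0,\eta_1,\dots$ are i.i.d. Bernoulli variables, independent of $x_0$, with $P(\eta_k=0)=p$ and $P(\eta_k=1)=1-p$; the received signal is $y_k=x_k$ if $\eta_k=1$ and $y_k=\emptyset$ (packet lost) if $\eta_k=0$. Put $\hat x_{k|k}=E[x_k\mid y_0,\dots,y_k]$ and $\tilde x_k=x_k-\hat x_{k|k}$. A pair of controls is admissible if, for every $k$, $u^R_k$ is $\sigma(y_0,\dots,y_k)$-measurable and $u^L_k$ is $\sigma(x_0,y_0,\dots,y_k)$-measurable. The cost is $$J=E\sum_{k=0}^\infty\left[x_k'Qx_k+(u^L_k)'R^Lu^L_k+(u^R_k)'R^Ru^R_k\right]\in[0,\infty].$$ The system is called mean-square stabilizable if there are constant matrices $K_1,K_2,L$ such that, with $u^R_k=-K_1\hat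 x_{k|k}$ and $u^L_k=-K_2\hat x_{k|k}-L\tilde x_k$, one has $\lim_{k\to\infty}E(x_k'x_k)=0$ for every Gaussian initial value $x_0$. Assume that $R^L>0$ and $R^R>0$ (symmetric positive definite), that $Q=C'C$ for some matrix $C$, and that $(A,Q^{1/2})$ is observable. Then the system is mean-square stabilizable if and only if there is exactly one pair $(Z,X)$ of real $n\times n$ matrices that solves the algebraic Riccati equations $$Z=A'ZA+Q-K'\Upsilon K,\qquad X=A'\Psi A+Q-M'\Lambda^{-1}M,$$ where $$K=\Upsilon^{-1}[B^L\ B^R]'ZA,\qquad \Upsilon=[B^L\ B^R]'Z[B^L\ B^R]+\begin{bmatrix}R^L&0\\0&R^R\end{bmatrix},$$ $$\Psi=(1-p)Z+pX,\qquad \Lambda=(B^L)'\Psi B^L+R^L,\qquad M=(B^L)'\Psi A,$$ and satisfies $Z>0$, $\Psi>0$ and $E[x_0'Z\hat x_{0|0}+x_0'X\tilde x_0]\ge 0$ for every Gaussian initial value $x_0$. In that case the stationary controls $$u^R_k=-[0\ \ I]\,K\hat x_{k|k},\qquad u^L_k=-[I\ \ 0]\,K\hat x_{k|k}-\Lambda^{-1}M\tilde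 x_k$$ stabilize the system in the mean-square sense (that is, $E(x_k'x_k)\to0$ for every Gaussian $x_0$), are admissible, and minimize $J$ over all admissible pairs of controls, for every Gaussian initial value $x_0$; the optimal cost is $$J^*=E[x_0'Z\hat x_{0|0}+x_0'X\tilde x_0].$$ -/

import Mathlib

open Filter Topology MeasureTheory ProbabilityTheory Matrix
open scoped ENNReal MatrixOrder

noncomputable section

/-- The data of the noise-free networked control system
`x (k+1) = A x k + BL uL k + BR uR k` with state dimension `n`, local control dimension `l`,
remote control dimension `r`, weights `Q`, `RL`, `RR`, and packet loss probability `p`. -/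
structure NCS (n l r : ℕ) where
  A : Matrix (Fin n) (Fin n) ℝ
  BL : Matrix (Fin n) (Fin l) ℝ
  BR : Matrix (Fin n) (Fin r) ℝ
  Q : Matrix (Fin n) (Fin n) ℝ
  RL : Matrix (Fin l) (Fin l) ℝ
  RR : Matrix (Fin r) (Fin r) ℝ
  p : ℝ

/-- `(A, C)` is observable: a free trajectory with zero output starts at `0`. -/
def Observable {n m : ℕ} (A : Matrix (Fin n) (Fin n) ℝ) (C : Matrix (Fin m) (Fin n) ℝ) : Prop :=
  ∀ v : Fin n → ℝ, (∀ k : ℕ, C *ᵥ ((A ^ k) *ᵥ v) = 0) → v = 0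

/-- Probabilistic setting: `x0` is Gaussian (with arbitrary mean and arbitrary, possibly singular,
covariance), the packet arrivals `η k` are independent and identically distributed with
`P (η k = 0) = p`, and the arrival sequence is independent of `x0`. -/
structure IsSetting {Ω : Type*} [MeasurableSpace Ω] (μ : Measure Ω) {n : ℕ} (p : ℝ)
    (x0 : Ω → Fin n → ℝ) (η : ℕ → Ω → Bool) : Prop where
  measurable_x0 : Measurable x0
  gaussian_x0 : IsGaussian (μ.map x0)
  measurable_η : ∀ k, Measurable (η k)
  prob_loss : ∀ k, μ {ω | η k ω = false} = ENNReal.ofReal p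
  indep_η : iIndepFun η μ
  indep_x0_η : IndepFun x0 (fun ω k => η k ω) μ

/-- The signal received by the remote controller when the arrival flag is `b` and the state is `v`:
the state, or an erasure symbol, here `(false, 0)`. -/
def received {n : ℕ} (b : Bool) (v : Fin n → ℝ) : Bool × (Fin n → ℝ) :=
  (b, if b then v else 0)

/-- The σ-algebra generated by the received signals `y 0, …, y k` along the state process `x`. -/
@[reducible] def remoteSigma {Ω : Type*} {n : ℕ} (η : ℕ → Ω → Bool) (x : ℕ → Ω → Fin n → ℝ) (k : ℕ) :
    MeasurableSpace Ω :=
  ⨆ j : Fin (k + 1), MeasurableSpace.comap (fun ω => received (η j ω) (x j ω)) inferInstance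

/-- The σ-algebra generated by `x 0` and the received signals `y 0, …, y k`. -/
@[reducible] def localSigma {Ω : Type*} {n : ℕ} (η : ℕ → Ω → Bool) (x : ℕ → Ω → Fin n → ℝ) (k : ℕ) :
    MeasurableSpace Ω :=
  MeasurableSpace.comap (x 0) inferInstance ⊔ remoteSigma η x k

/-- The remote estimate: the conditional expectation of `x k` given `y 0, …, y k`. -/
def estimate {Ω : Type*} [MeasurableSpace Ω] (μ : Measure Ω) {n : ℕ}
    (η : ℕ → Ω → Bool) (x : ℕ → Ω → Fin n → ℝ) (k : ℕ) : Ω → Fin n → ℝ :=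
  μ[x k | remoteSigma η x k]

/-- The estimation error. -/
def estError {Ω : Type*} [MeasurableSpace Ω] (μ : Measure Ω) {n : ℕ}
    (η : ℕ → Ω → Bool) (x : ℕ → Ω → Fin n → ℝ) (k : ℕ) : Ω → Fin n → ℝ :=
  fun ω => x k ω - estimate μ η x k ω

/-- The remote feedback `-K1 x̂`. -/
def remoteFeedback {Ω : Type*} [MeasurableSpace Ω] (μ : Measure Ω) {n r : ℕ}
    (η : ℕ → Ω → Bool) (K1 : Matrix (Fin r) (Fin n) ℝ) (x : ℕ → Ω → Fin n → ℝ) (k : ℕ) :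
    Ω → Fin r → ℝ :=
  fun ω => -(K1 *ᵥ estimate μ η x k ω)

/-- The local feedback `-K2 x̂ - L x̃`. -/
def localFeedback {Ω : Type*} [MeasurableSpace Ω] (μ : Measure Ω) {n l : ℕ}
    (η : ℕ → Ω → Bool) (K2 L : Matrix (Fin l) (Fin n) ℝ) (x : ℕ → Ω → Fin n → ℝ) (k : ℕ) :
    Ω → Fin l → ℝ :=
  fun ω => -(K2 *ᵥ estimate μ η x k ω) - L *ᵥ estError μ η x k ω

namespace NCS

variable {n l r : ℕ} (S : NCS n l r)

/-- `x` is the state process started at `x0` and driven by the controls `uL`, `uR`. -/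
def IsTrajectory {Ω : Type*} (x0 : Ω → Fin n → ℝ) (uL : ℕ → Ω → Fin l → ℝ)
    (uR : ℕ → Ω → Fin r → ℝ) (x : ℕ → Ω → Fin n → ℝ) : Prop :=
  x 0 = x0 ∧ ∀ k ω, x (k + 1) ω = S.A *ᵥ x k ω + S.BL *ᵥ uL k ω + S.BR *ᵥ uR k ω

/-- Admissible controls with the state process that they generate: the remote control at time `k`
is a function of `y 0, …, y k`, the local control a function of `x 0, y 0, …, y k`. -/
def IsAdmissible {Ω : Type*} (x0 : Ω → Fin n → ℝ) (η : ℕ → Ω → Bool)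
    (uL : ℕ → Ω → Fin l → ℝ) (uR : ℕ → Ω → Fin r → ℝ) (x : ℕ → Ω → Fin n → ℝ) : Prop :=
  S.IsTrajectory x0 uL uR x ∧
    (∀ k, Measurable[localSigma η x k] (uL k)) ∧ (∀ k, Measurable[remoteSigma η x k] (uR k))

/-- The infinite-horizon cost `E ∑ (x' Q x + uL' RL uL + uR' RR uR)`, possibly infinite. It is
used for positive semi-definite weights only. -/
def cost {Ω : Type*} [MeasurableSpace Ω] (μ : Measure Ω) (uL : ℕ → Ω → Fin l → ℝ)
    (uR : ℕ → Ω → Fin r → ℝ) (x : ℕ → Ω → Fin n → ℝ) : ℝ≥0∞ :=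
  ∫⁻ ω, ∑' k, ENNReal.ofReal (x k ω ⬝ᵥ S.Q *ᵥ x k ω + uL k ω ⬝ᵥ S.RL *ᵥ uL k ω
    + uR k ω ⬝ᵥ S.RR *ᵥ uR k ω) ∂μ

/-- The state process of the closed loop under `uR = -K1 x̂` and `uL = -K2 x̂ - L x̃`. The estimate
at time `k` is written out here so that the recursion over the past states is visible; the closed
loop equation in terms of the feedbacks is `closedLoop_isTrajectory`. -/
def closedLoop {Ω : Type*} [MeasurableSpace Ω] (μ : Measure Ω) (x0 : Ω → Fin n → ℝ)
    (η : ℕ → Ω → Bool) (K1 : Matrix (Fin r) (Fin n) ℝ) (K2 L : Matrix (Fin l) (Fin n) ℝ) :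
    ℕ → Ω → Fin n → ℝ
  | 0 => x0
  | k + 1 => fun ω =>
      let xk : Ω → Fin n → ℝ := closedLoop μ x0 η K1 K2 L k
      let m : MeasurableSpace Ω := ⨆ j : Fin (k + 1), MeasurableSpace.comap
        (fun ω => received (η j ω) (closedLoop μ x0 η K1 K2 L j ω)) inferInstance
      let xhat : Fin n → ℝ := (μ[xk | m]) ω
      S.A *ᵥ xk ω + S.BL *ᵥ (-(K2 *ᵥ xhat) - L *ᵥ (xk ω - xhat)) + S.BR *ᵥ (-(K1 *ᵥ xhat))
  termination_by k => k
  decreasing_by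
    · omega
    · exact j.isLt

theorem closedLoop_isTrajectory {Ω : Type*} [MeasurableSpace Ω] (μ : Measure Ω)
    (x0 : Ω → Fin n → ℝ) (η : ℕ → Ω → Bool) (K1 : Matrix (Fin r) (Fin n) ℝ)
    (K2 L : Matrix (Fin l) (Fin n) ℝ) :
    S.IsTrajectory x0 (localFeedback μ η K2 L (S.closedLoop μ x0 η K1 K2 L))
      (remoteFeedback μ η K1 (S.closedLoop μ x0 η K1 K2 L)) (S.closedLoop μ x0 η K1 K2 L) := by
  refine ⟨by rw [closedLoop], fun k ω => ?_⟩
  rw [closedLoop]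
  rfl

/-- The closed loop with gains `K1`, `K2`, `L`, started at `x0`, satisfies `E (x k)'(x k) → 0`. -/
def TendsToZeroInMeanSquare {Ω : Type*} [MeasurableSpace Ω] (μ : Measure Ω) (x0 : Ω → Fin n → ℝ)
    (η : ℕ → Ω → Bool) (K1 : Matrix (Fin r) (Fin n) ℝ) (K2 L : Matrix (Fin l) (Fin n) ℝ) : Prop :=
  Tendsto (fun k => ∫⁻ ω, ENNReal.ofReal
    (S.closedLoop μ x0 η K1 K2 L k ω ⬝ᵥ S.closedLoop μ x0 η K1 K2 L k ω) ∂μ) atTop (𝓝 0)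

/-- The controls `uR = -K1 x̂`, `uL = -K2 x̂ - L x̃` stabilize the system in the mean-square sense:
for every Gaussian initial value the closed-loop state tends to zero in mean square. -/
def StabilizedBy (K1 : Matrix (Fin r) (Fin n) ℝ) (K2 L : Matrix (Fin l) (Fin n) ℝ) : Prop :=
  ∀ (Ω : Type) [MeasurableSpace Ω] (μ : Measure Ω) [IsProbabilityMeasure μ]
    (x0 : Ω → Fin n → ℝ) (η : ℕ → Ω → Bool), IsSetting μ S.p x0 η →
    S.TendsToZeroInMeanSquare μ x0 η K1 K2 L

/-- Mean-square stabilizability by constant gains. -/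
def MeanSquareStabilizable : Prop :=
  ∃ (K1 : Matrix (Fin r) (Fin n) ℝ) (K2 L : Matrix (Fin l) (Fin n) ℝ), S.StabilizedBy K1 K2 L

/-- The block matrix `[BL BR]`. -/
def B : Matrix (Fin n) (Fin l ⊕ Fin r) ℝ := Matrix.fromCols S.BL S.BR

def Upsilon (Z : Matrix (Fin n) (Fin n) ℝ) : Matrix (Fin l ⊕ Fin r) (Fin l ⊕ Fin r) ℝ :=
  S.Bᵀ * Z * S.B + Matrix.fromBlocks S.RL 0 0 S.RR

def K (Z : Matrix (Fin n) (Fin n) ℝ) : Matrix (Fin l ⊕ Fin r) (Fin n) ℝ :=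
  (S.Upsilon Z)⁻¹ * S.Bᵀ * Z * S.A

def Psi (Z X : Matrix (Fin n) (Fin n) ℝ) : Matrix (Fin n) (Fin n) ℝ :=
  (1 - S.p) • Z + S.p • X

def Lambda (Z X : Matrix (Fin n) (Fin n) ℝ) : Matrix (Fin l) (Fin l) ℝ :=
  S.BLᵀ * S.Psi Z X * S.BL + S.RL

def M (Z X : Matrix (Fin n) (Fin n) ℝ) : Matrix (Fin l) (Fin n) ℝ :=
  S.BLᵀ * S.Psi Z X * S.A

/-- `E [x0' Z x̂ + x0' X x̃]`, with the estimate `x̂` of `x0` given `y 0` and its error `x̃`. -/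
def initialValue {Ω : Type*} [MeasurableSpace Ω] (μ : Measure Ω) (x0 : Ω → Fin n → ℝ)
    (η : ℕ → Ω → Bool) (Z X : Matrix (Fin n) (Fin n) ℝ) : ℝ :=
  ∫ ω, (x0 ω ⬝ᵥ Z *ᵥ estimate μ η (fun _ => x0) 0 ω
    + x0 ω ⬝ᵥ X *ᵥ estError μ η (fun _ => x0) 0 ω) ∂μ

/-- `Z` and `X` solve the two coupled algebraic Riccati equations, with `Z > 0`, `Ψ > 0` and
`E [x0' Z x̂ + x0' X x̃] ≥ 0` for every Gaussian initial value `x0`. -/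
structure IsRiccatiSolution (Z X : Matrix (Fin n) (Fin n) ℝ) : Prop where
  eq_Z : Z = S.Aᵀ * Z * S.A + S.Q - (S.K Z)ᵀ * S.Upsilon Z * S.K Z
  eq_X : X = S.Aᵀ * S.Psi Z X * S.A + S.Q - (S.M Z X)ᵀ * (S.Lambda Z X)⁻¹ * S.M Z X
  posDef_Z : Z.PosDef
  posDef_Psi : (S.Psi Z X).PosDef
  nonneg : ∀ (Ω : Type) [MeasurableSpace Ω] (μ : Measure Ω) [IsProbabilityMeasure μ]
    (x0 : Ω → Fin n → ℝ) (η : ℕ → Ω → Bool), IsSetting μ S.p x0 η →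
    0 ≤ initialValue μ x0 η Z X

/-- The stationary remote gain `[0 I] K`. -/
def remoteGain (Z : Matrix (Fin n) (Fin n) ℝ) : Matrix (Fin r) (Fin n) ℝ := (S.K Z).toRows₂

/-- The stationary local gain `[I 0] K`. -/
def localGain (Z : Matrix (Fin n) (Fin n) ℝ) : Matrix (Fin l) (Fin n) ℝ := (S.K Z).toRows₁

/-- The stationary local gain `Λ⁻¹ M` on the estimation error. -/
def errorGain (Z X : Matrix (Fin n) (Fin n) ℝ) : Matrix (Fin l) (Fin n) ℝ :=
  (S.Lambda Z X)⁻¹ * S.M Z X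

end NCS

end

/-! The state splits into the estimate `x̂` and the error `x̃`, which are orthogonal given the
remote information. Write `û` for the conditional mean of `uL`. Prediction sends the estimate to `a
= A x̂ + BL û + BR uR` and the error to `d = A x̃ + BL (uL - û)`. The next arrival is independent of
all this; it moves `d` into the estimate with probability `1 - p` and leaves it in the error with
probability `p`. Hence the value `E (x̂' Z x̂ + x̃' X x̃)` becomes `E (a' Z a + d' Ψ d)`, whatever
the controls (`IsAdmissible.expectedValue_succ_eq`). The decentralized problem thus decouples into
two linear-quadratic problems, one with control `(û, uR)` and one with control `uL - û`. Completing
the square in both gives `IsAdmissible.stageCost_add_expectedValue_succ`.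

Optimality: summing this identity telescopes. A control of finite cost has inputs and outputs
tending to zero in mean square, so by observability the state tends to zero and the terminal value
vanishes; the initial value is then a lower bound. For the stationary controls both squares are
zero, so the cost is at most the initial value. In particular it is finite, and the same
observability argument shows that they stabilize.

Uniqueness: the initial value is the optimal cost. For `x0 = v + g w` with `g` standard normal it
equals `v' Z v + w' Ψ w`, so `Z` and `Ψ` are determined, and `X` is the Riccati image of `Ψ`.

Existence: under stabilizing gains the mean evolves by `A - BL K2 - BR K1`, while second moments of
the error evolve by `A - BL L` with a factor `p` per step (`StabilizedBy.tendsto_gains`). Both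
decay, which bounds value iteration from zero; its monotone limits solve the two equations
(`exists_riccati_fixedPoint`), and observability gives definiteness. -/

/-! ### Orthogonality of conditional means and residuals -/

section QuadraticForms

variable {Ω : Type*} {m₀ : MeasurableSpace Ω} {μ : Measure Ω} {ι κ : Type*} [Fintype ι] [Fintype κ]

theorem MemLp.mulVec {p : ℝ≥0∞} {f : Ω → κ → ℝ} (hf : MemLp f p μ) (A : Matrix ι κ ℝ) :
    MemLp (fun ω => A *ᵥ f ω) p μ :=
  (LinearMap.toContinuousLinearMap A.mulVecLin).comp_memLp' hf

theorem MemLp.apply_coord {p : ℝ≥0∞} {f : Ω → ι → ℝ} (hf : MemLp f p μ) (i : ι) :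
    MemLp (fun ω => f ω i) p μ :=
  (ContinuousLinearMap.proj (R := ℝ) (φ := fun _ : ι => ℝ) i).comp_memLp' hf

theorem integrable_dotProduct {f g : Ω → ι → ℝ} (hf : MemLp f 2 μ) (hg : MemLp g 2 μ) :
    Integrable (fun ω => f ω ⬝ᵥ g ω) μ := by
  simp only [dotProduct]
  exact integrable_finsetSum _ fun i _ =>
    MemLp.integrable_mul (MemLp.apply_coord hf i) (MemLp.apply_coord hg i)

theorem integrable_dotProduct_mulVec {f : Ω → ι → ℝ} {g : Ω → κ → ℝ} (hf : MemLp f 2 μ)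
    (hg : MemLp g 2 μ) (S : Matrix ι κ ℝ) : Integrable (fun ω => f ω ⬝ᵥ S *ᵥ g ω) μ :=
  integrable_dotProduct hf (MemLp.mulVec hg S)

theorem condExp_mulVec {m : MeasurableSpace Ω} {f : Ω → κ → ℝ} (hf : Integrable f μ)
    (A : Matrix ι κ ℝ) :
    μ[fun ω => A *ᵥ f ω | m] =ᵐ[μ] fun ω => A *ᵥ (μ[f | m]) ω :=
  ((LinearMap.toContinuousLinearMap A.mulVecLin).comp_condExp_comm hf).symm

theorem condExp_apply_coord {m : MeasurableSpace Ω} {f : Ω → ι → ℝ} (hf : Integrable f μ) (i : ι) :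
    μ[fun ω => f ω i | m] =ᵐ[μ] fun ω => (μ[f | m]) ω i :=
  ((ContinuousLinearMap.proj (R := ℝ) (φ := fun _ : ι => ℝ) i).comp_condExp_comm hf).symm

/-- Orthogonality of an `m`-measurable vector and a vector with vanishing conditional mean. -/
theorem integral_dotProduct_eq_zero_of_condExp {m : MeasurableSpace Ω} [IsFiniteMeasure μ]
    (hm : m ≤ m₀) {g d : Ω → ι → ℝ} (hgm : StronglyMeasurable[m] g) (hg : MemLp g 2 μ)
    (hd : MemLp d 2 μ) (hd0 : μ[d | m] =ᵐ[μ] 0) : ∫ ω, g ω ⬝ᵥ d ω ∂μ = 0 := by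
  simp only [dotProduct]
  have hint (i : ι) : Integrable (fun ω => g ω i * d ω i) μ :=
    MemLp.integrable_mul (MemLp.apply_coord hg i) (MemLp.apply_coord hd i)
  rw [integral_finsetSum _ fun i _ => hint i]
  refine Finset.sum_eq_zero fun i _ => ?_
  have hgi : StronglyMeasurable[m] fun ω => g ω i :=
    (continuous_apply i).comp_stronglyMeasurable hgm
  have h1 := condExp_mul_of_stronglyMeasurable_left (μ := μ) hgi (hint i)
    ((MemLp.apply_coord hd i).integrable (by norm_num))
  have h2 := condExp_apply_coord (m := m) (hd.integrable (by norm_num)) i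
  rw [← integral_condExp hm]
  refine integral_eq_zero_of_ae (h1.trans ?_)
  filter_upwards [h2, hd0] with ω h2 h0
  simp [h2, h0]

theorem condExp_residual_eq_zero {E : Type*} [NormedAddCommGroup E] [NormedSpace ℝ E]
    [CompleteSpace E] {m : MeasurableSpace Ω} [IsFiniteMeasure μ] (hm : m ≤ m₀) {f : Ω → E}
    (hf : Integrable f μ) : μ[fun ω => f ω - (μ[f | m]) ω | m] =ᵐ[μ] 0 := by
  have h := condExp_sub hf (integrable_condExp (μ := μ) (m := m) (f := f)) m
  rw [condExp_of_stronglyMeasurable hm stronglyMeasurable_condExp integrable_condExp, sub_self] at h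
  exact h

theorem condExp_mulVec_eq_zero {m : MeasurableSpace Ω} {d : Ω → κ → ℝ} (hd : Integrable d μ)
    (hd0 : μ[d | m] =ᵐ[μ] 0) (A : Matrix ι κ ℝ) : μ[fun ω => A *ᵥ d ω | m] =ᵐ[μ] 0 := by
  filter_upwards [condExp_mulVec (m := m) hd A, hd0] with ω h1 h2
  simp [h1, h2]

/-- Second moments add up for an `m`-measurable vector and one with vanishing conditional mean. -/
theorem integral_quadratic_add {m : MeasurableSpace Ω} [IsFiniteMeasure μ]
    (hm : m ≤ m₀) {g d : Ω → ι → ℝ} (hgm : StronglyMeasurable[m] g) (hg : MemLp g 2 μ)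
    (hd : MemLp d 2 μ) (hd0 : μ[d | m] =ᵐ[μ] 0) (S : Matrix ι ι ℝ) :
    ∫ ω, (g ω + d ω) ⬝ᵥ S *ᵥ (g ω + d ω) ∂μ
      = ∫ ω, g ω ⬝ᵥ S *ᵥ g ω ∂μ + ∫ ω, d ω ⬝ᵥ S *ᵥ d ω ∂μ := by
  have h1 : ∫ ω, g ω ⬝ᵥ S *ᵥ d ω ∂μ = 0 :=
    integral_dotProduct_eq_zero_of_condExp hm hgm hg (MemLp.mulVec hd S)
      (condExp_mulVec_eq_zero (hd.integrable (by norm_num)) hd0 S)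
  have h2 : ∫ ω, d ω ⬝ᵥ S *ᵥ g ω ∂μ = 0 := by
    simp_rw [dotProduct_comm (d _)]
    exact integral_dotProduct_eq_zero_of_condExp hm
      ((LinearMap.toContinuousLinearMap S.mulVecLin).continuous.comp_stronglyMeasurable hgm)
      (MemLp.mulVec hg S) hd hd0
  have e (ω : Ω) : (g ω + d ω) ⬝ᵥ S *ᵥ (g ω + d ω) = (g ω ⬝ᵥ S *ᵥ g ω + d ω ⬝ᵥ S *ᵥ d ω)
      + (g ω ⬝ᵥ S *ᵥ d ω + d ω ⬝ᵥ S *ᵥ g ω) := by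
    simp only [mulVec_add, add_dotProduct, dotProduct_add]; ring
  simp_rw [e]
  have i (f₁ f₂ : Ω → ι → ℝ) (h₁ : MemLp f₁ 2 μ) (h₂ : MemLp f₂ 2 μ) :=
    integrable_dotProduct_mulVec h₁ h₂ S
  rw [integral_add ((i _ _ hg hg).fun_add (i _ _ hd hd)) ((i _ _ hg hd).fun_add (i _ _ hd hg)),
    integral_add (i _ _ hg hg) (i _ _ hd hd), integral_add (i _ _ hg hd) (i _ _ hd hg), h1, h2]
  ring

/-- The second moment splits into those of the conditional mean and of the residual. -/
theorem integral_quadratic_eq_condExp_add_residual {m : MeasurableSpace Ω} [IsFiniteMeasure μ]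
    (hm : m ≤ m₀) {f : Ω → ι → ℝ} (hf : MemLp f 2 μ) (S : Matrix ι ι ℝ) :
    ∫ ω, f ω ⬝ᵥ S *ᵥ f ω ∂μ = ∫ ω, (μ[f | m]) ω ⬝ᵥ S *ᵥ (μ[f | m]) ω ∂μ
      + ∫ ω, (f ω - (μ[f | m]) ω) ⬝ᵥ S *ᵥ (f ω - (μ[f | m]) ω) ∂μ := by
  have h := integral_quadratic_add hm stronglyMeasurable_condExp (hf.condExp (by norm_num))
    (hf.sub (hf.condExp (m := m) (by norm_num)))
    (condExp_residual_eq_zero hm (hf.integrable (by norm_num))) S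
  simpa using h

end QuadraticForms

/-! ### Filtering through the erasure channel -/

section ErasureChannel

variable {Ω : Type*}

theorem setIntegral_eq_smul_of_indep {E : Type*} [NormedAddCommGroup E] [NormedSpace ℝ E]
    [mE : MeasurableSpace E] [BorelSpace E] [SecondCountableTopology E]
    {H m₀ : MeasurableSpace Ω} {μ : Measure Ω} (hH : H ≤ m₀) {b : Ω → Bool}
    (hb : Measurable b) (hind : Indep H (MeasurableSpace.comap b inferInstance) μ) {h : Ω → E}
    (hh : Measurable[H] h) (c : Bool) :
    ∫ ω in {ω | b ω = c}, h ω ∂μ = μ.real {ω | b ω = c} • ∫ ω, h ω ∂μ :=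
  Indep.setIntegral_eq_smul (X := h) (f := fun x => x)
    (m := MeasurableSpace.comap b inferInstance) hb.comap_le
    (indep_of_indep_of_le_right hind.symm hh.comap_le) (hh.mono hH le_rfl).aemeasurable
    ⟨{c}, trivial, rfl⟩ aestronglyMeasurable_id

/-- On the loss event the received signal is constant, so it adds nothing to `m` there. The loss
half of the filter can therefore be tested on events of `m` alone. -/
theorem exists_inter_eq_of_measurableSet_sup_received {n : ℕ} {m : MeasurableSpace Ω}
    {b : Ω → Bool} {f : Ω → Fin n → ℝ} {s : Set Ω}
    (hs : MeasurableSet[m ⊔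
      MeasurableSpace.comap (fun ω => received (b ω) (f ω)) inferInstance] s) :
    ∃ t, MeasurableSet[m] t ∧ s ∩ {ω | b ω = false} = t ∩ {ω | b ω = false} := by
  -- The sets with the desired property form a σ-algebra, so only the two generating families have
  -- to be checked.
  let N : MeasurableSpace Ω :=
    { MeasurableSet' := fun s =>
        ∃ t, MeasurableSet[m] t ∧ s ∩ {ω | b ω = false} = t ∩ {ω | b ω = false}
      measurableSet_empty := ⟨∅, MeasurableSet.empty, rfl⟩
      measurableSet_compl := by
        rintro s ⟨t, ht, h⟩
        refine ⟨tᶜ, ht.compl, ?_⟩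
        ext ω
        have := congrArg (ω ∈ ·) h
        simp only [Set.mem_inter_iff, Set.mem_ofPred_eq, Set.mem_compl_iff] at this ⊢
        grind
      measurableSet_iUnion := by
        intro u hu
        choose t ht h using hu
        exact ⟨⋃ i, t i, MeasurableSet.iUnion ht, by simp_rw [Set.iUnion_inter, h]⟩ }
  refine (sup_le ?_ ?_ : _ ≤ N) s hs
  · exact fun t ht => ⟨t, ht, rfl⟩
  · rintro _ ⟨u, -, rfl⟩
    by_cases h0 : ((false, 0) : Bool × (Fin n → ℝ)) ∈ u
    · refine ⟨Set.univ, @MeasurableSet.univ _ m, ?_⟩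
      ext ω
      simp only [Set.mem_inter_iff, Set.mem_preimage, Set.mem_ofPred_eq, Set.mem_univ, true_and,
        and_iff_right_iff_imp]
      intro h
      simpa [received, h] using h0
    · refine ⟨∅, @MeasurableSet.empty _ m, ?_⟩
      ext ω
      simp only [Set.mem_inter_iff, Set.mem_preimage, Set.mem_ofPred_eq, Set.mem_empty_iff_false,
        false_and, iff_false, not_and]
      intro h hb
      exact h0 (by simpa [received, hb] using h)

variable {n : ℕ} {m H m₀ : MeasurableSpace Ω} {μ : Measure Ω} [IsProbabilityMeasure μ]
  {b : Ω → Bool} {f : Ω → Fin n → ℝ}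

/-- The filter for the erasure channel: the estimate is replaced by the state if the packet
arrives, and it is kept otherwise. -/
theorem condExp_sup_received (hmH : m ≤ H) (hH : H ≤ m₀) (hb : Measurable b)
    (hind : Indep H (MeasurableSpace.comap b inferInstance) μ) (hfH : Measurable[H] f)
    (hf : Integrable f μ) :
    μ[f | m ⊔ MeasurableSpace.comap (fun ω => received (b ω) (f ω)) inferInstance]
      =ᵐ[μ] fun ω => if b ω then f ω else (μ[f | m]) ω := by
  have hfm : Measurable f := hfH.mono hH le_rfl
  have hrec : Measurable fun ω => received (b ω) (f ω) := by
    unfold received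
    exact hb.prodMk (Measurable.ite (hb (MeasurableSet.singleton true)) hfm measurable_const)
  have hle : m ⊔ MeasurableSpace.comap (fun ω => received (b ω) (f ω)) inferInstance ≤ m₀ :=
    sup_le (hmH.trans hH) hrec.comap_le
  have hbs (c : Bool) : MeasurableSet {ω | b ω = c} := hb (MeasurableSet.singleton c)
  have hce : Measurable[m] (μ[f | m]) := stronglyMeasurable_condExp.measurable
  have hgint : Integrable (fun ω => if b ω then f ω else (μ[f | m]) ω) μ := by
    have := (hf.indicator (hbs true)).add
      ((integrable_condExp (μ := μ) (m := m) (f := f)).indicator (hbs false))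
    refine this.congr (ae_of_all _ fun ω => ?_)
    cases h : b ω <;> simp [Set.indicator, h]
  symm
  refine ae_eq_condExp_of_forall_setIntegral_eq hle hf (fun _ _ _ => hgint.integrableOn) ?_ ?_
  · intro s hs _
    obtain ⟨t, ht, hst⟩ := exists_inter_eq_of_measurableSet_sup_received hs
    have hs' : MeasurableSet s := hle s hs
    have ht' : MeasurableSet t := hH t (hmH t ht)
    have hcompl : {ω | b ω = true}ᶜ = {ω | b ω = false} := by ext; simp
    have split (g : Ω → Fin n → ℝ) (hg : Integrable g μ) :
        ∫ ω in s, g ω ∂μ = ∫ ω in s ∩ {ω | b ω = true}, g ω ∂μ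
          + ∫ ω in s ∩ {ω | b ω = false}, g ω ∂μ := by
      rw [← integral_inter_add_sdiff (hbs true) hg.integrableOn, Set.sdiff_eq, hcompl]
    rw [split _ hgint, split _ hf]
    congr 1
    · refine setIntegral_congr_fun (hs'.inter (hbs true)) fun ω hω => ?_
      simp only [Set.mem_inter_iff, Set.mem_ofPred_eq] at hω
      simp [hω.2]
    -- On the loss event `s` may be replaced by `t` in `m ≤ H`. Independence then pulls out the loss
    -- probability, and what remains is the defining property of `μ[f | m]`.
    · rw [hst]
      have h1 : ∫ ω in t ∩ {ω | b ω = false}, (if b ω then f ω else (μ[f | m]) ω) ∂μ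
          = ∫ ω in t ∩ {ω | b ω = false}, (μ[f | m]) ω ∂μ := by
        refine setIntegral_congr_fun (ht'.inter (hbs false)) fun ω hω => ?_
        simp only [Set.mem_inter_iff, Set.mem_ofPred_eq] at hω
        simp [hω.2]
      have h2 (g : Ω → Fin n → ℝ) (hg : Measurable[H] g) :
          ∫ ω in t ∩ {ω | b ω = false}, g ω ∂μ
            = μ.real {ω | b ω = false} • ∫ ω in t, g ω ∂μ := by
        rw [Set.inter_comm, ← integral_indicator ht', ← setIntegral_eq_smul_of_indep hH hb hind
          (hg.indicator (hmH t ht)), setIntegral_indicator ht']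
      rw [h1, h2 _ (hce.mono hmH le_rfl), h2 _ hfH, setIntegral_condExp (hmH.trans hH) hf ht]
  · refine StronglyMeasurable.aestronglyMeasurable (Measurable.stronglyMeasurable ?_)
    set m' := m ⊔ MeasurableSpace.comap (fun ω => received (b ω) (f ω)) inferInstance
    have hr : Measurable[m'] fun ω => received (b ω) (f ω) :=
      (comap_measurable _).mono le_sup_right le_rfl
    have hb' : Measurable[m'] b := measurable_fst.comp hr
    have hf' : Measurable[m'] fun ω => if b ω then f ω else 0 := measurable_snd.comp hr
    -- `f` itself need not be measurable for the enlarged σ-algebra; only its masked version, the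
    -- second component of the signal, is.
    have : (fun ω => if b ω then f ω else (μ[f | m]) ω)
        = fun ω => if b ω then (if b ω then f ω else 0) else (μ[f | m]) ω := by
      ext ω; cases b ω <;> simp
    rw [this]
    exact Measurable.ite (hb' (MeasurableSet.singleton true)) hf' (hce.mono le_sup_left le_rfl)

end ErasureChannel

section ErasureChannelMoments

variable {Ω : Type*} {n : ℕ} {m H m₀ : MeasurableSpace Ω} {μ : Measure Ω} [IsProbabilityMeasure μ]
  {b : Ω → Bool} {f : Ω → Fin n → ℝ}

/-- Expected quadratic cost of the estimate and of the error after one use of the channel. -/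
theorem integral_quadratic_sup_received (hmH : m ≤ H) (hH : H ≤ m₀) (hb : Measurable b)
    (hind : Indep H (MeasurableSpace.comap b inferInstance) μ) (hfH : Measurable[H] f)
    (hf : MemLp f 2 μ) {p : ℝ} (hp0 : 0 ≤ p) (hbp : μ {ω | b ω = false} = ENNReal.ofReal p)
    (Z X : Matrix (Fin n) (Fin n) ℝ) {g : Ω → Fin n → ℝ}
    (hg : g =ᵐ[μ] μ[f | m ⊔ MeasurableSpace.comap (fun ω => received (b ω) (f ω)) inferInstance]) :
    ∫ ω, (g ω ⬝ᵥ Z *ᵥ g ω + (f ω - g ω) ⬝ᵥ X *ᵥ (f ω - g ω)) ∂μ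
      = ∫ ω, (μ[f | m]) ω ⬝ᵥ Z *ᵥ (μ[f | m]) ω ∂μ
        + ∫ ω, (f ω - (μ[f | m]) ω) ⬝ᵥ ((1 - p) • Z + p • X) *ᵥ (f ω - (μ[f | m]) ω) ∂μ := by
  have hfi : Integrable f μ := hf.integrable (by norm_num)
  have hbs (c : Bool) : MeasurableSet {ω | b ω = c} := hb (MeasurableSet.singleton c)
  have hcompl : {ω | b ω = true}ᶜ = {ω | b ω = false} := by ext; simp
  have hpf : μ.real {ω | b ω = false} = p := by
    rw [measureReal_def, hbp, ENNReal.toReal_ofReal hp0]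
  have hpt : μ.real {ω | b ω = true} = 1 - p := by
    rw [← hpf, ← hcompl, probReal_compl_eq_one_sub (hbs true)]; ring
  set e := μ[f | m] with he
  have heL : MemLp e 2 μ := hf.condExp (by norm_num)
  have hdL : MemLp (fun ω => f ω - e ω) 2 μ := hf.sub heL
  have heH : Measurable[H] e := stronglyMeasurable_condExp.measurable.mono hmH le_rfl
  have hdH : Measurable[H] fun ω => f ω - e ω := hfH.sub heH
  have hq (S : Matrix (Fin n) (Fin n) ℝ) : Measurable fun v : Fin n → ℝ => v ⬝ᵥ S *ᵥ v :=
    (Continuous.dotProduct continuous_id (continuous_const.matrix_mulVec continuous_id)).measurable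
  have hZX : ∀ v : Fin n → ℝ, v ⬝ᵥ ((1 - p) • Z + p • X) *ᵥ v
      = (1 - p) * (v ⬝ᵥ Z *ᵥ v) + p * (v ⬝ᵥ X *ᵥ v) := fun v => by
    simp [add_mulVec, smul_mulVec, dotProduct_add, dotProduct_smul]
  have hqf : Measurable[H] fun ω => f ω ⬝ᵥ Z *ᵥ f ω := (hq Z).comp hfH
  have hqe : Measurable[H] fun ω => e ω ⬝ᵥ Z *ᵥ e ω + (f ω - e ω) ⬝ᵥ X *ᵥ (f ω - e ω) :=
    ((hq Z).comp heH).add ((hq X).comp hdH)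
  have iff := integrable_dotProduct_mulVec hf hf Z
  have iee := integrable_dotProduct_mulVec heL heL Z
  have idd := integrable_dotProduct_mulVec hdL hdL X
  have iddZ := integrable_dotProduct_mulVec hdL hdL Z
  -- After an arrival the estimate is `f` and the error is zero; after a loss both keep their
  -- predicted values. Splitting `E f' Z f` into estimate and residual turns the weight of the
  -- residual into `(1 - p) Z + p X`.
  have key : (fun ω => g ω ⬝ᵥ Z *ᵥ g ω + (f ω - g ω) ⬝ᵥ X *ᵥ (f ω - g ω)) =ᵐ[μ]
      fun ω => {ω | b ω = true}.indicator (fun ω => f ω ⬝ᵥ Z *ᵥ f ω) ω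
        + {ω | b ω = false}.indicator (fun ω => e ω ⬝ᵥ Z *ᵥ e ω
          + (f ω - e ω) ⬝ᵥ X *ᵥ (f ω - e ω)) ω := by
    filter_upwards [hg.trans (condExp_sup_received hmH hH hb hind hfH hfi)] with ω hω
    rw [hω]
    cases h : b ω <;> simp [h, he]
  rw [integral_congr_ae key, integral_add (iff.indicator (hbs _))
    ((iee.fun_add idd).indicator (hbs _)), integral_indicator (hbs _), integral_indicator (hbs _),
    setIntegral_eq_smul_of_indep hH hb hind hqf,
    setIntegral_eq_smul_of_indep hH hb hind hqe,
    integral_add iee idd, hpf, hpt, integral_quadratic_eq_condExp_add_residual (hmH.trans hH) hf Z,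
    ← he]
  simp_rw [hZX]
  rw [integral_add (iddZ.const_mul _) (idd.const_mul _), integral_const_mul, integral_const_mul]
  simp only [smul_eq_mul]
  ring

end ErasureChannelMoments

/-! ### Comparison of quadratic forms and mean-square convergence -/

section MeanSquare

variable {Ω : Type*} [MeasurableSpace Ω] {μ : Measure Ω} {ι κ : Type*} [Fintype ι] [Fintype κ]

theorem dotProduct_self_nonneg' (v : ι → ℝ) : 0 ≤ v ⬝ᵥ v :=
  Finset.sum_nonneg fun i _ => mul_self_nonneg (v i)

theorem exists_quadratic_le (S : Matrix ι ι ℝ) :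
    ∃ c : ℝ, 0 ≤ c ∧ ∀ v : ι → ℝ, v ⬝ᵥ S *ᵥ v ≤ c * (v ⬝ᵥ v) := by
  classical
  refine ⟨∑ i, ∑ j, |S i j|, by positivity, fun v => ?_⟩
  have h1 (i : ι) : v i * v i ≤ v ⬝ᵥ v :=
    Finset.single_le_sum (f := fun i => v i * v i) (fun i _ => mul_self_nonneg (v i))
      (Finset.mem_univ i)
  have h2 : v ⬝ᵥ S *ᵥ v = ∑ i, ∑ j, v i * (S i j * v j) := by
    simp only [dotProduct, mulVec, Finset.mul_sum]
  rw [h2, Finset.sum_mul]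
  refine Finset.sum_le_sum fun i _ => ?_
  rw [Finset.sum_mul]
  refine Finset.sum_le_sum fun j _ => ?_
  have h3 : v i * v j ≤ v ⬝ᵥ v ∧ -(v i * v j) ≤ v ⬝ᵥ v := by
    constructor <;> nlinarith [h1 i, h1 j, sq_nonneg (v i - v j), sq_nonneg (v i + v j)]
  rcases abs_cases (S i j) with ⟨h, _⟩ | ⟨h, _⟩ <;> rw [h] <;> nlinarith

theorem exists_dotProduct_mulVec_self_le (A : Matrix ι κ ℝ) :
    ∃ c : ℝ, 0 ≤ c ∧ ∀ v : κ → ℝ, A *ᵥ v ⬝ᵥ A *ᵥ v ≤ c * (v ⬝ᵥ v) := by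
  obtain ⟨c, hc, h⟩ := exists_quadratic_le (Aᵀ * A)
  refine ⟨c, hc, fun v => (h v).trans' (le_of_eq ?_)⟩
  rw [← mulVec_mulVec, dotProduct_mulVec v, vecMul_transpose]

/-- Factor `S = Bᵀ B`; `B` is invertible because `S` is, so `v = B⁻¹ (B v)` and a bound for `B⁻¹`
serves as the constant. -/
theorem Matrix.PosDef.exists_le_quadratic {S : Matrix ι ι ℝ} (hS : S.PosDef) :
    ∃ c : ℝ, 0 ≤ c ∧ ∀ v : ι → ℝ, v ⬝ᵥ v ≤ c * (v ⬝ᵥ S *ᵥ v) := by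
  classical
  obtain ⟨B, hB⟩ := CStarAlgebra.nonneg_iff_eq_star_mul_self.mp
    (nonneg_iff_posSemidef.mpr hS.posSemidef)
  have hBu : IsUnit B.det := by
    refine isUnit_of_mul_isUnit_right (x := (star B).det) ?_
    rw [← det_mul, ← hB]
    exact (Matrix.isUnit_iff_isUnit_det _).mp hS.isUnit
  obtain ⟨c, hc, h⟩ := exists_dotProduct_mulVec_self_le B⁻¹
  refine ⟨c, hc, fun v => ?_⟩
  have h1 := h (B *ᵥ v)
  rw [mulVec_mulVec, nonsing_inv_mul _ hBu, one_mulVec] at h1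
  rwa [hB, ← mulVec_mulVec, dotProduct_mulVec v, star_eq_conjTranspose,
    conjTranspose_eq_transpose_of_trivial, vecMul_transpose]

/-- Convergence to zero in mean square of a sequence of random vectors. -/
def MSTendstoZero (μ : Measure Ω) (f : ℕ → Ω → ι → ℝ) : Prop :=
  Tendsto (fun k => ∫⁻ ω, ENNReal.ofReal (f k ω ⬝ᵥ f k ω) ∂μ) atTop (𝓝 0)

theorem MSTendstoZero.of_le {f : ℕ → Ω → ι → ℝ} {g : ℕ → Ω → κ → ℝ} (hf : MSTendstoZero μ f) {c : ℝ}
    (h : ∀ k ω, g k ω ⬝ᵥ g k ω ≤ c * (f k ω ⬝ᵥ f k ω)) : MSTendstoZero μ g := by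
  have h1 := ENNReal.Tendsto.const_mul (a := ENNReal.ofReal c) hf (Or.inr ENNReal.ofReal_ne_top)
  rw [mul_zero] at h1
  refine tendsto_of_tendsto_of_tendsto_of_le_of_le tendsto_const_nhds h1 (fun _ => zero_le)
    fun k => ?_
  dsimp only
  rw [← lintegral_const_mul' _ _ ENNReal.ofReal_ne_top]
  refine lintegral_mono fun ω => ?_
  dsimp only
  rw [← ENNReal.ofReal_mul' (dotProduct_self_nonneg' _)]
  exact ENNReal.ofReal_le_ofReal (h k ω)

theorem MSTendstoZero.mulVec {f : ℕ → Ω → κ → ℝ} (hf : MSTendstoZero μ f) (A : Matrix ι κ ℝ) :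
    MSTendstoZero μ fun k ω => A *ᵥ f k ω := by
  obtain ⟨c, _, h⟩ := exists_dotProduct_mulVec_self_le A
  exact hf.of_le fun k ω => h (f k ω)

theorem MSTendstoZero.neg {f : ℕ → Ω → κ → ℝ} (hf : MSTendstoZero μ f) :
    MSTendstoZero μ fun k ω => -f k ω :=
  hf.of_le (c := 1) fun k ω => by simp

theorem MSTendstoZero.add {f g : ℕ → Ω → ι → ℝ} (hf : MSTendstoZero μ f) (hg : MSTendstoZero μ g)
    (hfm : ∀ k, Measurable (f k)) : MSTendstoZero μ fun k ω => f k ω + g k ω := by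
  have h1 := ENNReal.Tendsto.const_mul (a := 2) (Filter.Tendsto.add hf hg)
    (Or.inr (by norm_num))
  rw [add_zero, mul_zero] at h1
  refine tendsto_of_tendsto_of_tendsto_of_le_of_le tendsto_const_nhds h1 (fun _ => zero_le)
    fun k => ?_
  dsimp only
  have hm : Measurable fun ω => ENNReal.ofReal (f k ω ⬝ᵥ f k ω) := by
    have : Measurable fun v : ι → ℝ => v ⬝ᵥ v :=
      (Continuous.dotProduct continuous_id continuous_id).measurable
    exact (this.comp (hfm k)).ennreal_ofReal
  rw [← lintegral_add_left hm, ← lintegral_const_mul' _ _ (by norm_num)]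
  refine lintegral_mono fun ω => ?_
  dsimp only
  rw [← ENNReal.ofReal_add (dotProduct_self_nonneg' _) (dotProduct_self_nonneg' _),
    ← ENNReal.ofReal_ofNat, ← ENNReal.ofReal_mul (by norm_num)]
  refine ENNReal.ofReal_le_ofReal ?_
  have := dotProduct_self_nonneg' (f k ω - g k ω)
  simp only [dotProduct_sub, sub_dotProduct, dotProduct_add, add_dotProduct,
    dotProduct_comm (g k ω) (f k ω)] at *
  linarith

end MeanSquare

/-! ### Observability: from outputs to states -/

section Observability

variable {n m : ℕ} {A : Matrix (Fin n) (Fin n) ℝ} {C : Matrix (Fin m) (Fin n) ℝ}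

/-- The subspaces of vectors with zero output before time `N` decrease with `N`, so by the
descending chain condition they become stationary. -/
theorem Observable.exists_finite_horizon (h : Observable A C) :
    ∃ N : ℕ, ∀ v : Fin n → ℝ, (∀ k < N, C *ᵥ ((A ^ k) *ᵥ v) = 0) → v = 0 := by
  let U : ℕ →o (Submodule ℝ (Fin n → ℝ))ᵒᵈ :=
    { toFun := fun N => OrderDual.toDual (⨅ k, ⨅ (_ : k < N), LinearMap.ker (C * A ^ k).mulVecLin)
      monotone' := fun a b hab => by
        rw [OrderDual.toDual_le_toDual]
        exact biInf_mono fun k hk => lt_of_lt_of_le hk hab }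
  obtain ⟨N, hN⟩ := IsArtinian.monotone_stabilizes U
  have hmem (M : ℕ) (v : Fin n → ℝ) :
      v ∈ OrderDual.ofDual (U M) ↔ ∀ k < M, C *ᵥ ((A ^ k) *ᵥ v) = 0 := by
    simp [U, Submodule.mem_iInf, mulVec_mulVec]
  refine ⟨N, fun v hv => h v fun k => ?_⟩
  have hvM : v ∈ OrderDual.ofDual (U (max N (k + 1))) := by
    rw [← hN _ (le_max_left _ _)]; exact (hmem N v).mpr hv
  exact (hmem _ v).mp hvM k (by omega)

/-- Finite-horizon observability inequality. -/
theorem Observable.exists_dotProduct_le_sum (h : Observable A C) :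
    ∃ (N : ℕ) (c : ℝ), 0 ≤ c ∧ ∀ v : Fin n → ℝ, v ⬝ᵥ v ≤
      c * ∑ k ∈ Finset.range N, C *ᵥ ((A ^ k) *ᵥ v) ⬝ᵥ C *ᵥ ((A ^ k) *ᵥ v) := by
  obtain ⟨N, hN⟩ := h.exists_finite_horizon
  have hq (v : Fin n → ℝ) : v ⬝ᵥ (∑ k ∈ Finset.range N, (C * A ^ k)ᵀ * (C * A ^ k)) *ᵥ v
      = ∑ k ∈ Finset.range N, C *ᵥ ((A ^ k) *ᵥ v) ⬝ᵥ C *ᵥ ((A ^ k) *ᵥ v) := by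
    rw [sum_mulVec, dotProduct_sum]
    refine Finset.sum_congr rfl fun k _ => ?_
    rw [← mulVec_mulVec, dotProduct_mulVec v, vecMul_transpose, mulVec_mulVec]
  have hpd : (∑ k ∈ Finset.range N, (C * A ^ k)ᵀ * (C * A ^ k)).PosDef := by
    refine PosDef.of_dotProduct_mulVec_pos ?_ fun v hv => ?_
    · rw [IsHermitian, conjTranspose_eq_transpose_of_trivial, transpose_sum]
      simp [transpose_mul]
    · rw [star_trivial, hq]
      refine lt_of_le_of_ne (Finset.sum_nonneg fun k _ => dotProduct_self_nonneg' _) fun h0 => hv ?_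
      refine hN v fun k hk => ?_
      exact dotProduct_self_eq_zero.mp ((Finset.sum_eq_zero_iff_of_nonneg
        fun k _ => dotProduct_self_nonneg' _).mp h0.symm k (Finset.mem_range.mpr hk))
  obtain ⟨c, hc, h⟩ := hpd.exists_le_quadratic
  exact ⟨N, c, hc, fun v => by rw [← hq]; exact h v⟩

/-- An observable system with inputs and outputs tending to zero in mean square has a state that
tends to zero in mean square. -/
theorem MSTendstoZero.of_observable {Ω : Type*} [MeasurableSpace Ω] {μ : Measure Ω}
    (h : Observable A C) {x w : ℕ → Ω → Fin n → ℝ}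
    (hxw : ∀ k ω, x (k + 1) ω = A *ᵥ x k ω + w k ω) (hxm : ∀ k, Measurable (x k))
    (hw : MSTendstoZero μ w) (hC : MSTendstoZero μ fun k ω => C *ᵥ x k ω) :
    MSTendstoZero μ x := by
  have hmul {a b : ℕ} (M : Matrix (Fin a) (Fin b) ℝ) : Measurable fun v : Fin b → ℝ => M *ᵥ v :=
    (LinearMap.toContinuousLinearMap M.mulVecLin).continuous.measurable
  -- Over any fixed number of steps the vanishing inputs displace the trajectory from the free
  -- evolution by a vanishing amount. The free outputs hence vanish too, and the finite-horizon
  -- inequality applies.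
  have hd : ∀ j : ℕ, MSTendstoZero μ fun k ω => (A ^ j) *ᵥ x k ω - x (k + j) ω := by
    intro j
    induction j with
    | zero => simp [MSTendstoZero]
    | succ j ih =>
      have h1 : MSTendstoZero μ fun k ω => -w (k + j) ω :=
        MSTendstoZero.neg (hw.comp (tendsto_add_atTop_nat j))
      have h2 := (ih.mulVec A).add h1 fun k =>
        (hmul A).comp (((hmul _).comp (hxm k)).sub (hxm (k + j)))
      convert h2 using 3 with k ω
      rw [← add_assoc, hxw, pow_succ', ← mulVec_mulVec, mulVec_sub]
      abel
  have hCA (j : ℕ) : MSTendstoZero μ fun k ω => C *ᵥ ((A ^ j) *ᵥ x k ω) := by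
    have h1 : MSTendstoZero μ fun k ω => C *ᵥ x (k + j) ω := hC.comp (tendsto_add_atTop_nat j)
    have h2 := ((hd j).mulVec C).add h1 fun k =>
      (hmul C).comp (((hmul _).comp (hxm k)).sub (hxm (k + j)))
    simpa [mulVec_sub] using h2
  obtain ⟨N, c, hc, hle⟩ := h.exists_dotProduct_le_sum
  have hs := tendsto_finsetSum (Finset.range N) fun j _ => hCA j
  have h1 := ENNReal.Tendsto.const_mul (a := ENNReal.ofReal c) hs (Or.inr ENNReal.ofReal_ne_top)
  rw [Finset.sum_const_zero, mul_zero] at h1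
  refine tendsto_of_tendsto_of_tendsto_of_le_of_le tendsto_const_nhds h1 (fun _ => zero_le)
    fun k => ?_
  dsimp only
  have hm (j : ℕ) : Measurable fun ω =>
      ENNReal.ofReal (C *ᵥ ((A ^ j) *ᵥ x k ω) ⬝ᵥ C *ᵥ ((A ^ j) *ᵥ x k ω)) := by
    have : Measurable fun v : Fin m → ℝ => v ⬝ᵥ v :=
      (Continuous.dotProduct continuous_id continuous_id).measurable
    exact (this.comp ((hmul C).comp ((hmul _).comp (hxm k)))).ennreal_ofReal
  rw [← lintegral_finsetSum _ fun j _ => hm j, ← lintegral_const_mul' _ _ ENNReal.ofReal_ne_top]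
  refine lintegral_mono fun ω => ?_
  dsimp only
  rw [← ENNReal.ofReal_sum_of_nonneg fun j _ => dotProduct_self_nonneg' _,
    ← ENNReal.ofReal_mul hc]
  exact ENNReal.ofReal_le_ofReal (hle _)

end Observability

/-! ### The Riccati map, value iteration and definiteness -/

section Riccati

variable {ι κ : Type*} [Fintype ι] [Fintype κ]

theorem Matrix.PosSemidef.dotProduct_mulVec_nonneg' {S : Matrix ι ι ℝ} (h : S.PosSemidef)
    (v : ι → ℝ) :
    0 ≤ v ⬝ᵥ S *ᵥ v := by
  simpa using h.dotProduct_mulVec_nonneg v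

theorem Matrix.PosSemidef.transpose_mul_mul_same {S : Matrix ι ι ℝ} (h : S.PosSemidef)
    (B : Matrix ι κ ℝ) : (Bᵀ * S * B).PosSemidef := by
  simpa using h.conjTranspose_mul_mul_same B

theorem Matrix.IsHermitian.transpose_eq {ι : Type*} {S : Matrix ι ι ℝ} (h : S.IsHermitian) :
    Sᵀ = S := by
  simpa using h.eq

theorem dotProduct_mulVec_transpose (S : Matrix ι κ ℝ) (v : ι → ℝ) (w : κ → ℝ) :
    w ⬝ᵥ Sᵀ *ᵥ v = v ⬝ᵥ S *ᵥ w := by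
  rw [mulVec_transpose, dotProduct_comm, dotProduct_mulVec]

theorem posDef_riccatiWeight {B : Matrix ι κ ℝ} {R : Matrix κ κ ℝ} {V : Matrix ι ι ℝ}
    (hR : R.PosDef) (hV : V.PosSemidef) : (Bᵀ * V * B + R).PosDef :=
  hR.posSemidef_add (hV.transpose_mul_mul_same B)

theorem dotProduct_sqrt_mulVec_self [DecidableEq ι] {Q : Matrix ι ι ℝ} (hQ : Q.PosSemidef)
    (v : ι → ℝ) : CFC.sqrt Q *ᵥ v ⬝ᵥ CFC.sqrt Q *ᵥ v = v ⬝ᵥ Q *ᵥ v := by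
  have h0 : 0 ≤ Q := nonneg_iff_posSemidef.mpr hQ
  have hs : (CFC.sqrt Q)ᵀ = CFC.sqrt Q :=
    (nonneg_iff_posSemidef.mp (CFC.sqrt_nonneg Q)).isHermitian.transpose_eq
  conv_rhs => rw [← CFC.sqrt_mul_sqrt_self Q h0, ← mulVec_mulVec]
  nth_rewrite 3 [← hs]
  rw [dotProduct_mulVec_transpose]

variable [DecidableEq κ]

/-- The optimal gain of a one-step linear-quadratic problem with terminal weight `V`. -/
noncomputable def riccatiGain (A : Matrix ι ι ℝ) (B : Matrix ι κ ℝ) (R : Matrix κ κ ℝ)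
    (V : Matrix ι ι ℝ) : Matrix κ ι ℝ :=
  (Bᵀ * V * B + R)⁻¹ * (Bᵀ * V * A)

/-- The optimal value of a one-step linear-quadratic problem with terminal weight `V`. -/
noncomputable def riccatiMap (A : Matrix ι ι ℝ) (B : Matrix ι κ ℝ) (Q : Matrix ι ι ℝ)
    (R : Matrix κ κ ℝ) (V : Matrix ι ι ℝ) : Matrix ι ι ℝ :=
  Aᵀ * V * A + Q - (Bᵀ * V * A)ᵀ * (Bᵀ * V * B + R)⁻¹ * (Bᵀ * V * A)

variable {A : Matrix ι ι ℝ} {B : Matrix ι κ ℝ} {Q : Matrix ι ι ℝ} {R : Matrix κ κ ℝ}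
  {V W : Matrix ι ι ℝ}

/-- Completion of the square. -/
theorem riccatiMap_completion (hR : R.PosDef) (hV : V.PosSemidef) (v : ι → ℝ) (u : κ → ℝ) :
    (A *ᵥ v + B *ᵥ u) ⬝ᵥ V *ᵥ (A *ᵥ v + B *ᵥ u) + v ⬝ᵥ Q *ᵥ v + u ⬝ᵥ R *ᵥ u
      = v ⬝ᵥ riccatiMap A B Q R V *ᵥ v
        + (u + riccatiGain A B R V *ᵥ v) ⬝ᵥ (Bᵀ * V * B + R) *ᵥ (u + riccatiGain A B R V *ᵥ v) := by
  have hΛ := posDef_riccatiWeight (B := B) hR hV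
  have hdet : IsUnit (Bᵀ * V * B + R).det := (Matrix.isUnit_iff_isUnit_det _).mp hΛ.isUnit
  set Λ := Bᵀ * V * B + R with hΛdef
  set N := Bᵀ * V * A with hN
  clear_value N Λ
  have hΛt : Λᵀ = Λ := hΛ.isHermitian.transpose_eq
  have hVt : Vᵀ = V := hV.isHermitian.transpose_eq
  have h1 : Λ *ᵥ (riccatiGain A B R V *ᵥ v) = N *ᵥ v := by
    rw [mulVec_mulVec, riccatiGain, ← hΛdef, ← hN, mul_nonsing_inv_cancel_left _ _ hdet]
  have h2 : (riccatiGain A B R V *ᵥ v) ⬝ᵥ Λ *ᵥ u = u ⬝ᵥ N *ᵥ v := by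
    rw [← h1, ← dotProduct_mulVec_transpose, hΛt]
  have h3 : (riccatiGain A B R V *ᵥ v) ⬝ᵥ N *ᵥ v = v ⬝ᵥ (Nᵀ * Λ⁻¹ * N) *ᵥ v := by
    rw [riccatiGain, ← hΛdef, ← hN, ← mulVec_mulVec, ← mulVec_mulVec, ← mulVec_mulVec,
      dotProduct_mulVec_transpose]
  have h4 : (B *ᵥ u) ⬝ᵥ V *ᵥ (A *ᵥ v) = u ⬝ᵥ N *ᵥ v := by
    rw [hN, ← mulVec_mulVec, ← mulVec_mulVec, dotProduct_mulVec_transpose, dotProduct_comm]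
  have h5 : (A *ᵥ v) ⬝ᵥ V *ᵥ (B *ᵥ u) = u ⬝ᵥ N *ᵥ v := by
    rw [← h4, ← dotProduct_mulVec_transpose, hVt]
  have h6 : (A *ᵥ v) ⬝ᵥ V *ᵥ (A *ᵥ v) = v ⬝ᵥ (Aᵀ * V * A) *ᵥ v := by
    rw [← mulVec_mulVec, ← mulVec_mulVec, dotProduct_mulVec_transpose, dotProduct_comm]
  have h7 : (B *ᵥ u) ⬝ᵥ V *ᵥ (B *ᵥ u) + u ⬝ᵥ R *ᵥ u = u ⬝ᵥ Λ *ᵥ u := by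
    rw [hΛdef, add_mulVec, dotProduct_add, ← mulVec_mulVec, ← mulVec_mulVec,
      dotProduct_mulVec_transpose, dotProduct_comm]
  rw [riccatiMap, ← hN, ← hΛdef]
  simp only [mulVec_add, add_dotProduct, dotProduct_add, sub_mulVec, dotProduct_sub, add_mulVec,
    h1, h2, h3, h4, h5, h6] at h7 ⊢
  linarith

theorem riccatiMap_isHermitian (hR : R.PosDef) (hQ : Q.PosSemidef) (hV : V.PosSemidef) :
    (riccatiMap A B Q R V).IsHermitian := by
  have hVt : Vᵀ = V := hV.isHermitian.transpose_eq
  rw [IsHermitian, conjTranspose_eq_transpose_of_trivial, riccatiMap]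
  simp only [transpose_sub, transpose_add, transpose_mul, transpose_transpose, hVt,
    hQ.isHermitian.transpose_eq, transpose_nonsing_inv, hR.isHermitian.transpose_eq,
    Matrix.mul_assoc]

theorem riccatiMap_le (hR : R.PosDef) (hV : V.PosSemidef) (v : ι → ℝ) (u : κ → ℝ) :
    v ⬝ᵥ riccatiMap A B Q R V *ᵥ v ≤
      (A *ᵥ v + B *ᵥ u) ⬝ᵥ V *ᵥ (A *ᵥ v + B *ᵥ u) + v ⬝ᵥ Q *ᵥ v + u ⬝ᵥ R *ᵥ u := by
  rw [riccatiMap_completion hR hV]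
  exact le_add_of_nonneg_right
    ((posDef_riccatiWeight hR hV).posSemidef.dotProduct_mulVec_nonneg' _)

theorem riccatiMap_eq (hR : R.PosDef) (hV : V.PosSemidef) (v : ι → ℝ) :
    v ⬝ᵥ riccatiMap A B Q R V *ᵥ v =
      (A *ᵥ v + B *ᵥ (-(riccatiGain A B R V *ᵥ v))) ⬝ᵥ V *ᵥ
        (A *ᵥ v + B *ᵥ (-(riccatiGain A B R V *ᵥ v))) + v ⬝ᵥ Q *ᵥ v
        + (-(riccatiGain A B R V *ᵥ v)) ⬝ᵥ R *ᵥ (-(riccatiGain A B R V *ᵥ v)) := by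
  rw [riccatiMap_completion hR hV, neg_add_cancel, zero_dotProduct, add_zero]

theorem riccatiMap_posSemidef (hR : R.PosDef) (hQ : Q.PosSemidef) (hV : V.PosSemidef) :
    (riccatiMap A B Q R V).PosSemidef := by
  refine PosSemidef.of_dotProduct_mulVec_nonneg (riccatiMap_isHermitian hR hQ hV) fun v => ?_
  rw [star_trivial, riccatiMap_eq hR hV]
  exact add_nonneg (add_nonneg (hV.dotProduct_mulVec_nonneg' _) (hQ.dotProduct_mulVec_nonneg' _))
    (hR.posSemidef.dotProduct_mulVec_nonneg' _)

/-- The control that is optimal for `W` is a competitor in the minimization for `V`. -/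
theorem riccatiMap_mono (hR : R.PosDef) (hV : V.PosSemidef) (hW : W.PosSemidef)
    (h : ∀ v : ι → ℝ, v ⬝ᵥ V *ᵥ v ≤ v ⬝ᵥ W *ᵥ v) (v : ι → ℝ) :
    v ⬝ᵥ riccatiMap A B Q R V *ᵥ v ≤ v ⬝ᵥ riccatiMap A B Q R W *ᵥ v := by
  rw [riccatiMap_eq hR hW]
  refine (riccatiMap_le hR hV v (-(riccatiGain A B R W *ᵥ v))).trans ?_
  gcongr
  exact h _

theorem ContinuousAt.matrix_mul {α a b c : Type*} [TopologicalSpace α] [Fintype b]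
    {f : α → Matrix a b ℝ} {g : α → Matrix b c ℝ} {x : α} (hf : ContinuousAt f x)
    (hg : ContinuousAt g x) : ContinuousAt (fun y => f y * g y) x :=
  (continuous_fst.matrix_mul continuous_snd : Continuous
    fun y : Matrix a b ℝ × Matrix b c ℝ => y.1 * y.2).continuousAt.comp (hf.prodMk hg)

theorem tendsto_riccatiMap {V : ℕ → Matrix ι ι ℝ} {V' : Matrix ι ι ℝ}
    (hR : R.PosDef) (hV' : V'.PosSemidef) (h : Tendsto V atTop (𝓝 V')) :
    Tendsto (fun k => riccatiMap A B Q R (V k)) atTop (𝓝 (riccatiMap A B Q R V')) := by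
  have hc : ContinuousAt (riccatiMap A B Q R) V' := by
    have hinv : ContinuousAt (fun V : Matrix ι ι ℝ => (Bᵀ * V * B + R)⁻¹) V' := by
      have hdet : (Bᵀ * V' * B + R).det ≠ 0 := (posDef_riccatiWeight hR hV').det_pos.ne'
      have : Continuous fun V : Matrix ι ι ℝ => Bᵀ * V * B + R := by fun_prop
      simp only [Matrix.inv_def, Ring.inverse_eq_inv']
      exact ((this.matrix_det.continuousAt).inv₀ hdet).smul this.matrix_adjugate.continuousAt
    have hN : ContinuousAt (fun V : Matrix ι ι ℝ => Bᵀ * V * A) V' :=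
      Continuous.continuousAt (by fun_prop)
    have hA : ContinuousAt (fun V : Matrix ι ι ℝ => Aᵀ * V * A + Q) V' :=
      Continuous.continuousAt (by fun_prop)
    have hT : ContinuousAt (fun V : Matrix ι ι ℝ => (Bᵀ * V * A)ᵀ) V' :=
      Continuous.continuousAt (by fun_prop)
    unfold riccatiMap
    exact hA.sub ((hT.matrix_mul hinv).matrix_mul hN)
  exact hc.tendsto.comp h

/-- A gain whose closed loop is exponentially stable, up to the discount `p`, gives a
supersolution of the Riccati recursion. -/
theorem exists_lyapunov_supersolution {G : Matrix ι ι ℝ} [DecidableEq ι] {p : ℝ} (hp : 0 ≤ p)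
    (hG : ∀ v : ι → ℝ, Tendsto (fun k : ℕ => p ^ k * ((G ^ k) *ᵥ v ⬝ᵥ (G ^ k) *ᵥ v)) atTop (𝓝 0))
    (S : Matrix ι ι ℝ) :
    ∃ y : (ι → ℝ) → ℝ, (∀ v, 0 ≤ y v) ∧ ∀ v, v ⬝ᵥ S *ᵥ v + p * y (G *ᵥ v) ≤ y v := by
  obtain ⟨c, hc, hS⟩ := exists_quadratic_le S
  -- The Frobenius bound: decay on the finitely many basis vectors yields one exponent `k` at which
  -- the discounted power contracts every `v` by `1 / 2`.
  have hle (M : Matrix ι ι ℝ) (v : ι → ℝ) : M *ᵥ v ⬝ᵥ M *ᵥ v ≤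
      (∑ i, M *ᵥ Pi.single i 1 ⬝ᵥ M *ᵥ Pi.single i 1) * (v ⬝ᵥ v) := by
    have h1 : ∑ i, M *ᵥ Pi.single i 1 ⬝ᵥ M *ᵥ Pi.single i 1 = ∑ a, ∑ i, M a i ^ 2 := by
      rw [Finset.sum_comm]
      refine Finset.sum_congr rfl fun i _ => ?_
      simp [dotProduct, sq]
    rw [h1, Finset.sum_mul]
    refine Finset.sum_le_sum fun a _ => ?_
    have := Finset.sum_mul_sq_le_sq_mul_sq Finset.univ (M a) v
    simpa [mulVec, dotProduct, ← sq] using this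
  have hsum : Tendsto (fun k : ℕ => ∑ i, p ^ k *
      ((G ^ k) *ᵥ Pi.single i 1 ⬝ᵥ (G ^ k) *ᵥ Pi.single i 1)) atTop (𝓝 0) := by
    simpa using tendsto_finsetSum Finset.univ fun i _ => hG (Pi.single i (1 : ℝ))
  obtain ⟨k, hk⟩ := (hsum.eventually (gt_mem_nhds (show (0 : ℝ) < 1 / 2 by norm_num))).exists
  have hhalf (v : ι → ℝ) : p ^ k * ((G ^ k) *ᵥ v ⬝ᵥ (G ^ k) *ᵥ v) ≤ 1 / 2 * (v ⬝ᵥ v) := by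
    calc _ ≤ p ^ k * ((∑ i, (G ^ k) *ᵥ Pi.single i 1 ⬝ᵥ (G ^ k) *ᵥ Pi.single i 1) * (v ⬝ᵥ v)) := by
          gcongr; exact hle _ _
      _ = (∑ i, p ^ k * ((G ^ k) *ᵥ Pi.single i 1 ⬝ᵥ (G ^ k) *ᵥ Pi.single i 1)) * (v ⬝ᵥ v) := by
          rw [← Finset.mul_sum, mul_assoc]
      _ ≤ _ := mul_le_mul_of_nonneg_right hk.le (dotProduct_self_nonneg' _)
  -- The truncated Lyapunov sum over `k` steps suffices. It telescopes to a decrease of at least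
  -- half of `v ⬝ᵥ v`, and the factor `2` compensates for that half.
  refine ⟨fun v => 2 * c * ∑ j ∈ Finset.range k, p ^ j * ((G ^ j) *ᵥ v ⬝ᵥ (G ^ j) *ᵥ v),
    fun v => ?_, fun v => ?_⟩
  · exact mul_nonneg (by positivity) (Finset.sum_nonneg fun j _ =>
      mul_nonneg (pow_nonneg hp j) (dotProduct_self_nonneg' _))
  · have htel : ∑ j ∈ Finset.range k, p ^ j * ((G ^ j) *ᵥ v ⬝ᵥ (G ^ j) *ᵥ v)
        - p * ∑ j ∈ Finset.range k, p ^ j * ((G ^ j) *ᵥ (G *ᵥ v) ⬝ᵥ (G ^ j) *ᵥ (G *ᵥ v))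
        = v ⬝ᵥ v - p ^ k * ((G ^ k) *ᵥ v ⬝ᵥ (G ^ k) *ᵥ v) := by
      have := Finset.sum_range_sub' (fun j => p ^ j * ((G ^ j) *ᵥ v ⬝ᵥ (G ^ j) *ᵥ v)) k
      rw [Finset.sum_sub_distrib] at this
      simp only [pow_zero, one_mulVec, one_mul] at this
      rw [← this, Finset.mul_sum]
      congr 1
      refine Finset.sum_congr rfl fun j _ => ?_
      rw [mulVec_mulVec, ← pow_succ, pow_succ' p, mul_assoc]
    have h1 := hhalf v
    have h2 := hS v
    have h3 : c * (v ⬝ᵥ v) ≤ 2 * c * (v ⬝ᵥ v - p ^ k * ((G ^ k) *ᵥ v ⬝ᵥ (G ^ k) *ᵥ v)) := by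
      nlinarith
    rw [← htel] at h3
    linarith

/-- A sequence of symmetric matrices with convergent quadratic forms converges. -/
theorem exists_tendsto_of_quadratic [DecidableEq ι] {X : ℕ → Matrix ι ι ℝ}
    (hX : ∀ k, (X k).IsHermitian)
    (h : ∀ v : ι → ℝ, ∃ a, Tendsto (fun k => v ⬝ᵥ X k *ᵥ v) atTop (𝓝 a)) :
    ∃ X', Tendsto X atTop (𝓝 X') := by
  choose a ha using h
  -- Polarization recovers the entries from the quadratic form.
  have he (k : ℕ) (i j : ι) : X k i j = ((Pi.single i 1 + Pi.single j 1) ⬝ᵥ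
      X k *ᵥ (Pi.single i 1 + Pi.single j 1) - Pi.single i 1 ⬝ᵥ X k *ᵥ Pi.single i 1
      - Pi.single j 1 ⬝ᵥ X k *ᵥ Pi.single j 1) / 2 := by
    have : X k j i = X k i j := by simpa using (hX k).apply i j
    simp only [mulVec_add, add_dotProduct, dotProduct_add, single_one_dotProduct, mulVec_single_one,
      col_apply, this]
    ring
  refine ⟨fun i j => (a (Pi.single i 1 + Pi.single j 1) - a (Pi.single i 1)
    - a (Pi.single j 1)) / 2, ?_⟩
  refine tendsto_pi_nhds.mpr fun i => tendsto_pi_nhds.mpr fun j => ?_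
  simp_rw [he]
  exact (((ha _).sub (ha _)).sub (ha _)).div_const 2

/-- Value iteration: existence of a solution of the algebraic Riccati equation with terminal
weight `W + p X`, under discounted stabilizability. -/
theorem exists_riccati_fixedPoint [DecidableEq ι] (hQ : Q.PosSemidef) (hR : R.PosDef)
    (hW : W.PosSemidef) {p : ℝ} (hp : 0 ≤ p) (L : Matrix κ ι ℝ)
    (hL : ∀ v : ι → ℝ, Tendsto (fun k : ℕ => p ^ k *
      (((A - B * L) ^ k) *ᵥ v ⬝ᵥ ((A - B * L) ^ k) *ᵥ v)) atTop (𝓝 0)) :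
    ∃ X : Matrix ι ι ℝ, X.PosSemidef ∧ X = riccatiMap A B Q R (W + p • X) := by
  -- The weight collects the stage cost and the `W` part of the terminal cost under the feedback `-L
  -- v`, so `y` dominates the iterates from zero by comparison with this suboptimal control.
  obtain ⟨y, hy0, hy⟩ := exists_lyapunov_supersolution hp hL
    ((A - B * L)ᵀ * W * (A - B * L) + Q + Lᵀ * R * L)
  let X : ℕ → Matrix ι ι ℝ := fun k => (fun Y => riccatiMap A B Q R (W + p • Y))^[k] 0
  have hX0 : X 0 = 0 := rfl
  have hXs (k : ℕ) : X (k + 1) = riccatiMap A B Q R (W + p • X k) :=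
    Function.iterate_succ_apply' _ _ _
  have hwt {Y : Matrix ι ι ℝ} (hY : Y.PosSemidef) : (W + p • Y).PosSemidef := hW.add (hY.smul hp)
  have hq (Y : Matrix ι ι ℝ) (v : ι → ℝ) :
      v ⬝ᵥ (W + p • Y) *ᵥ v = v ⬝ᵥ W *ᵥ v + p * (v ⬝ᵥ Y *ᵥ v) := by
    simp [add_mulVec, smul_mulVec, dotProduct_add, dotProduct_smul]
  have hpsd (k : ℕ) : (X k).PosSemidef := by
    induction k with
    | zero => rw [hX0]; exact PosSemidef.zero
    | succ k ih => rw [hXs]; exact riccatiMap_posSemidef hR hQ (hwt ih)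
  have hmono (k : ℕ) : ∀ v : ι → ℝ, v ⬝ᵥ X k *ᵥ v ≤ v ⬝ᵥ X (k + 1) *ᵥ v := by
    induction k with
    | zero => intro v; simpa [hX0] using (hpsd 1).dotProduct_mulVec_nonneg' v
    | succ k ih =>
      intro v
      rw [hXs, hXs]
      refine riccatiMap_mono hR (hwt (hpsd _)) (hwt (hpsd _)) (fun v => ?_) v
      rw [hq, hq]
      gcongr
      exact ih v
  have hbound (k : ℕ) : ∀ v : ι → ℝ, v ⬝ᵥ X k *ᵥ v ≤ y v := by
    induction k with
    | zero => intro v; simpa [hX0] using hy0 v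
    | succ k ih =>
      intro v
      rw [hXs]
      refine (riccatiMap_le hR (hwt (hpsd k)) v (-(L *ᵥ v))).trans ((hy v).trans' ?_)
      have e1 : A *ᵥ v + B *ᵥ (-(L *ᵥ v)) = (A - B * L) *ᵥ v := by
        rw [mulVec_neg, sub_mulVec, mulVec_mulVec, sub_eq_add_neg]
      have e2 : v ⬝ᵥ ((A - B * L)ᵀ * W * (A - B * L) + Q + Lᵀ * R * L) *ᵥ v
          = ((A - B * L) *ᵥ v) ⬝ᵥ W *ᵥ ((A - B * L) *ᵥ v) + v ⬝ᵥ Q *ᵥ v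
            + (L *ᵥ v) ⬝ᵥ R *ᵥ (L *ᵥ v) := by
        rw [add_mulVec, add_mulVec, dotProduct_add, dotProduct_add]
        congr 1
        · congr 1
          rw [← mulVec_mulVec, ← mulVec_mulVec, dotProduct_mulVec_transpose, dotProduct_comm]
        · rw [← mulVec_mulVec, ← mulVec_mulVec, dotProduct_mulVec_transpose, dotProduct_comm]
      rw [e1, e2, hq]
      have := mul_le_mul_of_nonneg_left (ih ((A - B * L) *ᵥ v)) hp
      simp only [mulVec_neg, neg_dotProduct_neg]
      linarith
  obtain ⟨X', hX'⟩ := exists_tendsto_of_quadratic (fun k => (hpsd k).isHermitian) fun v =>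
    ⟨_, tendsto_atTop_ciSup (monotone_nat_of_le_succ fun k => hmono k v)
      ⟨y v, by rintro _ ⟨k, rfl⟩; exact hbound k v⟩⟩
  have hpsd' : X'.PosSemidef := by
    refine PosSemidef.of_dotProduct_mulVec_nonneg ?_ fun v => ?_
    · rw [IsHermitian, conjTranspose_eq_transpose_of_trivial]
      refine tendsto_nhds_unique ?_ hX'
      have := (continuous_id.matrix_transpose.tendsto X').comp hX'
      refine this.congr fun k => ?_
      exact (hpsd k).isHermitian.transpose_eq
    · rw [star_trivial]
      have hc : Continuous fun Y : Matrix ι ι ℝ => v ⬝ᵥ Y *ᵥ v :=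
        Continuous.dotProduct continuous_const (continuous_id.matrix_mulVec continuous_const)
      exact ge_of_tendsto' ((hc.tendsto X').comp hX') fun k => (hpsd k).dotProduct_mulVec_nonneg' v
  refine ⟨X', hpsd', ?_⟩
  have h1 : Tendsto (fun k => X (k + 1)) atTop (𝓝 (riccatiMap A B Q R (W + p • X'))) := by
    simp_rw [hXs]
    exact tendsto_riccatiMap hR (hwt hpsd') ((hX'.const_smul p).const_add W)
  exact tendsto_nhds_unique (hX'.comp (tendsto_add_atTop_nat 1)) h1

/-- Observability makes a positive semi-definite solution positive definite. -/
theorem posDef_of_riccati_fixedPoint {n : ℕ} {A Q X : Matrix (Fin n) (Fin n) ℝ}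
    {B : Matrix (Fin n) κ ℝ} (hQ : Q.PosSemidef) (hR : R.PosDef) (hX : X.PosSemidef)
    (hfix : X = riccatiMap A B Q R X) (hobs : Observable A (CFC.sqrt Q)) : X.PosDef := by
  -- A null vector of `X` has zero optimal cost. Since `R > 0`, its optimal control is zero, so it
  -- is also null for `Q`, and `A` maps it to a null vector. Its free trajectory thus has zero
  -- output.
  have hstep (v : Fin n → ℝ) (hv : v ⬝ᵥ X *ᵥ v = 0) :
      v ⬝ᵥ Q *ᵥ v = 0 ∧ (A *ᵥ v) ⬝ᵥ X *ᵥ (A *ᵥ v) = 0 := by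
    have h := riccatiMap_eq (A := A) (B := B) (Q := Q) hR hX v
    rw [← hfix, hv] at h
    set u := -(riccatiGain A B R X *ᵥ v)
    have h1 := hX.dotProduct_mulVec_nonneg' (A *ᵥ v + B *ᵥ u)
    have h2 := hQ.dotProduct_mulVec_nonneg' v
    have h3 := hR.posSemidef.dotProduct_mulVec_nonneg' u
    have hu : u = 0 := by
      obtain ⟨c, hc, hle⟩ := hR.exists_le_quadratic
      have h0 : u ⬝ᵥ R *ᵥ u = 0 := by linarith
      have := hle u
      rw [h0, mul_zero] at this
      exact dotProduct_self_eq_zero.mp (le_antisymm this (dotProduct_self_nonneg' u))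
    rw [hu, mulVec_zero, add_zero] at h h1
    simp only [zero_dotProduct, add_zero] at h
    constructor <;> linarith
  refine PosDef.of_dotProduct_mulVec_pos hX.isHermitian fun v hv => ?_
  rw [star_trivial]
  refine lt_of_le_of_ne (hX.dotProduct_mulVec_nonneg' v) fun h0 => hv (hobs v fun k => ?_)
  have hk : ((A ^ k) *ᵥ v) ⬝ᵥ X *ᵥ ((A ^ k) *ᵥ v) = 0 := by
    induction k with
    | zero => simpa using h0.symm
    | succ k ih => rw [pow_succ', ← mulVec_mulVec]; exact (hstep _ ih).2
  have hQk := (hstep _ hk).1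
  rwa [← dotProduct_sqrt_mulVec_self hQ, dotProduct_self_eq_zero] at hQk

end Riccati

/-! ### Information structure and independence of the next arrival -/

section History

variable {Ω : Type*}

/-- Intersections of an `m₁`-event with an `m₂`-event form a generating π-system, on which the two
hypotheses factor the probability. -/
theorem indep_sup_left {m₁ m₂ m₃ m₀ : MeasurableSpace Ω} {μ : Measure Ω} [IsProbabilityMeasure μ]
    (hm₁ : m₁ ≤ m₀) (hm₂ : m₂ ≤ m₀) (hm₃ : m₃ ≤ m₀)
    (h1 : Indep m₁ (m₂ ⊔ m₃) μ) (h2 : Indep m₂ m₃ μ) : Indep (m₁ ⊔ m₂) m₃ μ := by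
  have hgen : m₁ ⊔ m₂ = MeasurableSpace.generateFrom
      (Set.image2 (· ∩ ·) {s | MeasurableSet[m₁] s} {s | MeasurableSet[m₂] s}) := by
    apply le_antisymm
    · refine sup_le (fun s hs => ?_) fun s hs => ?_
      · exact MeasurableSpace.measurableSet_generateFrom
          ⟨s, hs, Set.univ, @MeasurableSet.univ _ m₂, Set.inter_univ s⟩
      · exact MeasurableSpace.measurableSet_generateFrom
          ⟨Set.univ, @MeasurableSet.univ _ m₁, s, hs, Set.univ_inter s⟩
    · refine MeasurableSpace.generateFrom_le ?_
      rintro _ ⟨s, hs, t, ht, rfl⟩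
      exact (le_sup_left (a := m₁) (b := m₂) s hs).inter (le_sup_right (a := m₁) (b := m₂) t ht)
  refine IndepSets.indep (sup_le hm₁ hm₂) hm₃ ?_ (@MeasurableSpace.isPiSystem_measurableSet _ m₃)
    hgen (@MeasurableSpace.generateFrom_measurableSet _ m₃).symm ?_
  · rintro _ ⟨s, hs, t, ht, rfl⟩ _ ⟨s', hs', t', ht', rfl⟩ -
    exact ⟨s ∩ s', MeasurableSet.inter hs hs', t ∩ t', MeasurableSet.inter ht ht',
      (Set.inter_inter_inter_comm s t s' t').symm⟩
  · rw [IndepSets_iff]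
    rintro _ u ⟨s, hs, t, ht, rfl⟩ hu
    rw [Indep_iff] at h1 h2
    have ht' := le_sup_left (a := m₂) (b := m₃) t ht
    have hu' := le_sup_right (a := m₂) (b := m₃) u hu
    rw [Set.inter_assoc, h1 s (t ∩ u) hs (MeasurableSet.inter ht' hu'), h2 t u ht hu,
      h1 s t hs ht', mul_assoc]

/-- The σ-algebra generated by `x0` and the arrivals before time `k`. -/
@[reducible] def history {n : ℕ} (x0 : Ω → Fin n → ℝ) (η : ℕ → Ω → Bool) (k : ℕ) :
    MeasurableSpace Ω :=
  MeasurableSpace.comap x0 inferInstance ⊔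
    ⨆ j ∈ Set.Iio k, MeasurableSpace.comap (η j) inferInstance

variable {n : ℕ} {x0 : Ω → Fin n → ℝ} {η : ℕ → Ω → Bool} {x : ℕ → Ω → Fin n → ℝ}

theorem history_mono : Monotone (history x0 η) := fun _ _ h =>
  sup_le_sup le_rfl (biSup_mono fun _ hj => lt_of_lt_of_le hj h)

/-- The join with `⊥` makes time zero an instance of the channel update, with no prior information.
-/
theorem remoteSigma_zero (η : ℕ → Ω → Bool) (x : ℕ → Ω → Fin n → ℝ) : remoteSigma η x 0 =
    ⊥ ⊔ MeasurableSpace.comap (fun ω => received (η 0 ω) (x 0 ω)) inferInstance := by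
  rw [bot_sup_eq]
  exact ciSup_unique (s := fun j : Fin 1 =>
    MeasurableSpace.comap (fun ω => received (η j ω) (x j ω)) inferInstance)

theorem remoteSigma_succ (η : ℕ → Ω → Bool) (x : ℕ → Ω → Fin n → ℝ) (k : ℕ) :
    remoteSigma η x (k + 1) = remoteSigma η x k ⊔
      MeasurableSpace.comap (fun ω => received (η (k + 1) ω) (x (k + 1) ω)) inferInstance := by
  apply le_antisymm
  · refine iSup_le fun j => ?_
    induction j using Fin.lastCases with
    | last => exact le_sup_right
    | cast j => exact le_sup_of_le_left (le_iSup (fun j : Fin (k + 1) =>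
        MeasurableSpace.comap (fun ω => received (η j ω) (x j ω)) inferInstance) j)
  · refine sup_le (iSup_le fun j => ?_) ?_
    · exact le_iSup (fun j : Fin (k + 1 + 1) =>
        MeasurableSpace.comap (fun ω => received (η j ω) (x j ω)) inferInstance) j.castSucc
    · exact le_iSup (fun j : Fin (k + 1 + 1) =>
        MeasurableSpace.comap (fun ω => received (η j ω) (x j ω)) inferInstance) (Fin.last (k + 1))

theorem localSigma_mono : Monotone (localSigma η x) :=
  monotone_nat_of_le_succ fun k => sup_le_sup le_rfl (by rw [remoteSigma_succ]; exact le_sup_left)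

/-- `history` at time `k` omits the arrival at time `k`, which the signal `y k` reveals; hence the
index `k + 1` on the right. -/
theorem localSigma_le_history (h0 : x 0 = x0) {k : ℕ}
    (hx : ∀ j ≤ k, Measurable[history x0 η j] (x j)) : localSigma η x k ≤ history x0 η (k + 1) := by
  refine sup_le (h0 ▸ le_sup_left) (iSup_le fun j => ?_)
  have hj : (j : ℕ) ≤ k := Nat.lt_succ_iff.mp j.isLt
  rw [← measurable_iff_comap_le]
  have hη : Measurable[history x0 η (k + 1)] (η j) := by
    rw [measurable_iff_comap_le]
    exact le_sup_of_le_right (le_iSup₂_of_le (j : ℕ) (Set.mem_Iio.mpr j.isLt) le_rfl)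
  have hxj : Measurable[history x0 η (k + 1)] (x j) :=
    (hx j hj).mono (history_mono (hj.trans (Nat.le_succ k))) le_rfl
  unfold received
  exact hη.prodMk (Measurable.ite (hη (MeasurableSet.singleton true)) hxj measurable_const)

end History

section Setting

variable {Ω : Type*} [MeasurableSpace Ω] {μ : Measure Ω} {n : ℕ} {p : ℝ} {x0 : Ω → Fin n → ℝ}
  {η : ℕ → Ω → Bool}

theorem IsSetting.history_le (h : IsSetting μ p x0 η) (k : ℕ) :
    history x0 η k ≤ (inferInstance : MeasurableSpace Ω) :=
  sup_le h.measurable_x0.comap_le (iSup₂_le fun j _ => (h.measurable_η j).comap_le)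

/-- The channel update at time `k` needs exactly this: whatever precedes the transmission, including
the state being sent, is independent of its fate. -/
theorem IsSetting.indep_history [IsProbabilityMeasure μ] (h : IsSetting μ p x0 η) (k : ℕ) :
    Indep (history x0 η k) (MeasurableSpace.comap (η k) inferInstance) μ := by
  have hle (j : ℕ) : MeasurableSpace.comap (η j) inferInstance
      ≤ MeasurableSpace.comap (fun ω k => η k ω) inferInstance := by
    rw [← measurable_iff_comap_le]
    exact (measurable_pi_apply j).comp (comap_measurable (fun (ω : Ω) (k : ℕ) => η k ω))
  refine indep_sup_left h.measurable_x0.comap_le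
    (iSup₂_le fun j _ => (h.measurable_η j).comap_le) (h.measurable_η k).comap_le ?_ ?_
  · exact indep_of_indep_of_le_right h.indep_x0_η
      (sup_le (iSup₂_le fun j _ => hle j) (hle k))
  · have := indep_iSup_of_disjoint (fun j => (h.measurable_η j).comap_le) h.indep_η.iIndep
      (S := Set.Iio k) (T := {k}) (by simp)
    simpa using this

theorem IsSetting.memLp_x0 (h : IsSetting μ p x0 η) : MemLp x0 2 μ := by
  have := h.gaussian_x0
  exact (memLp_map_measure_iff aestronglyMeasurable_id h.measurable_x0.aemeasurable).mp
    (IsGaussian.memLp_two_id (μ := μ.map x0))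

end Setting

/-! ### Expected values and the dynamic programming identity -/

section Quadratic

variable {Ω : Type*} [MeasurableSpace Ω] {μ : Measure Ω} {ι κ : Type*} [Fintype ι] [Fintype κ]
  [DecidableEq κ]

/-- Completion of the square under the expectation. -/
theorem integral_riccatiMap_completion {A : Matrix ι ι ℝ} {B : Matrix ι κ ℝ} {Q V : Matrix ι ι ℝ}
    {R : Matrix κ κ ℝ} (hR : R.PosDef) (hV : V.PosSemidef) {v : Ω → ι → ℝ} {u : Ω → κ → ℝ}
    (hv : MemLp v 2 μ) (hu : MemLp u 2 μ) :
    ∫ ω, (A *ᵥ v ω + B *ᵥ u ω) ⬝ᵥ V *ᵥ (A *ᵥ v ω + B *ᵥ u ω) ∂μ + ∫ ω, v ω ⬝ᵥ Q *ᵥ v ω ∂μ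
        + ∫ ω, u ω ⬝ᵥ R *ᵥ u ω ∂μ
      = ∫ ω, v ω ⬝ᵥ riccatiMap A B Q R V *ᵥ v ω ∂μ
        + ∫ ω, (u ω + riccatiGain A B R V *ᵥ v ω) ⬝ᵥ
            (Bᵀ * V * B + R) *ᵥ (u ω + riccatiGain A B R V *ᵥ v ω) ∂μ := by
  have hf : MemLp (fun ω => A *ᵥ v ω + B *ᵥ u ω) 2 μ := (MemLp.mulVec hv A).add (MemLp.mulVec hu B)
  have hg : MemLp (fun ω => u ω + riccatiGain A B R V *ᵥ v ω) 2 μ := hu.add (MemLp.mulVec hv _)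
  rw [← integral_add (integrable_dotProduct_mulVec hf hf V) (integrable_dotProduct_mulVec hv hv Q),
    ← integral_add ((integrable_dotProduct_mulVec hf hf V).fun_add
      (integrable_dotProduct_mulVec hv hv Q)) (integrable_dotProduct_mulVec hu hu R),
    ← integral_add (integrable_dotProduct_mulVec hv hv _) (integrable_dotProduct_mulVec hg hg _)]
  exact integral_congr_ae (ae_of_all _ fun ω => riccatiMap_completion hR hV (v ω) (u ω))

end Quadratic

namespace NCS

variable {n l r : ℕ} {S : NCS n l r} {Ω : Type*} [MeasurableSpace Ω] {μ : Measure Ω}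
  {x0 : Ω → Fin n → ℝ} {η : ℕ → Ω → Bool} {uL : ℕ → Ω → Fin l → ℝ} {uR : ℕ → Ω → Fin r → ℝ}
  {x : ℕ → Ω → Fin n → ℝ}

omit [MeasurableSpace Ω] in
-- Controls at time `k` depend on all signals up to `k`, and these on all earlier states; hence
-- strong induction.
theorem IsAdmissible.measurable_history (h : S.IsAdmissible x0 η uL uR x) (k : ℕ) :
    Measurable[history x0 η k] (x k) := by
  induction k using Nat.strong_induction_on with
  | _ k ih =>
  cases k with
  | zero => rw [h.1.1]; exact (comap_measurable x0).mono le_sup_left le_rfl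
  | succ k =>
    have hle := localSigma_le_history h.1.1 fun j hj => ih j (Nat.lt_succ_of_le hj)
    have hx : Measurable[history x0 η (k + 1)] (x k) :=
      (ih k (Nat.lt_succ_self k)).mono (history_mono (Nat.le_succ k)) le_rfl
    have hL : Measurable[history x0 η (k + 1)] (uL k) := (h.2.1 k).mono hle le_rfl
    have hR : Measurable[history x0 η (k + 1)] (uR k) :=
      (h.2.2 k).mono (le_sup_right.trans hle) le_rfl
    have hmul {a b : ℕ} (M : Matrix (Fin a) (Fin b) ℝ) : Measurable fun v : Fin b → ℝ => M *ᵥ v :=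
      (LinearMap.toContinuousLinearMap M.mulVecLin).continuous.measurable
    rw [show x (k + 1) = fun ω => S.A *ᵥ x k ω + S.BL *ᵥ uL k ω + S.BR *ᵥ uR k ω from
      funext (h.1.2 k)]
    exact (((hmul _).comp hx).add ((hmul _).comp hL)).add ((hmul _).comp hR)

omit [MeasurableSpace Ω] in
theorem IsAdmissible.localSigma_le_history (h : S.IsAdmissible x0 η uL uR x) (k : ℕ) :
    localSigma η x k ≤ history x0 η (k + 1) :=
  _root_.localSigma_le_history h.1.1 fun j _ => h.measurable_history j

omit [MeasurableSpace Ω] in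
theorem IsAdmissible.remoteSigma_le_history (h : S.IsAdmissible x0 η uL uR x) (k : ℕ) :
    remoteSigma η x k ≤ history x0 η (k + 1) :=
  le_sup_right.trans (h.localSigma_le_history k)

theorem IsAdmissible.memLp {p : ℝ} (h : S.IsAdmissible x0 η uL uR x) (hset : IsSetting μ p x0 η)
    (hL : ∀ k, MemLp (uL k) 2 μ) (hR : ∀ k, MemLp (uR k) 2 μ) (k : ℕ) : MemLp (x k) 2 μ := by
  induction k with
  | zero => rw [h.1.1]; exact hset.memLp_x0
  | succ k ih =>
    rw [show x (k + 1) = fun ω => S.A *ᵥ x k ω + S.BL *ᵥ uL k ω + S.BR *ᵥ uR k ω from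
      funext (h.1.2 k)]
    exact ((MemLp.mulVec ih S.A).add (MemLp.mulVec (hL k) S.BL)).add (MemLp.mulVec (hR k) S.BR)

/-- The expected value function along a trajectory. -/
noncomputable def expectedValue (μ : Measure Ω) (η : ℕ → Ω → Bool) (x : ℕ → Ω → Fin n → ℝ)
    (Z X : Matrix (Fin n) (Fin n) ℝ) (k : ℕ) : ℝ :=
  ∫ ω, (estimate μ η x k ω ⬝ᵥ Z *ᵥ estimate μ η x k ω
    + estError μ η x k ω ⬝ᵥ X *ᵥ estError μ η x k ω) ∂μ

/-- The expected running cost. -/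
noncomputable def expectedStageCost (S : NCS n l r) (μ : Measure Ω) (uL : ℕ → Ω → Fin l → ℝ)
    (uR : ℕ → Ω → Fin r → ℝ) (x : ℕ → Ω → Fin n → ℝ) (k : ℕ) : ℝ :=
  ∫ ω, (x k ω ⬝ᵥ S.Q *ᵥ x k ω + uL k ω ⬝ᵥ S.RL *ᵥ uL k ω + uR k ω ⬝ᵥ S.RR *ᵥ uR k ω) ∂μ

variable [IsProbabilityMeasure μ]

/-- One-step prediction of the state. -/
theorem IsAdmissible.condExp_succ (h : S.IsAdmissible x0 η uL uR x) (hset : IsSetting μ S.p x0 η)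
    (hL : ∀ k, MemLp (uL k) 2 μ) (hR : ∀ k, MemLp (uR k) 2 μ) (k : ℕ) :
    μ[x (k + 1) | remoteSigma η x k] =ᵐ[μ] fun ω => S.A *ᵥ estimate μ η x k ω
      + S.BL *ᵥ (μ[uL k | remoteSigma η x k]) ω + S.BR *ᵥ uR k ω := by
  have hle := (h.remoteSigma_le_history k).trans (hset.history_le (k + 1))
  have hx := h.memLp hset hL hR k
  have i1 := (MemLp.mulVec hx S.A).integrable (by norm_num)
  have i2 := (MemLp.mulVec (hL k) S.BL).integrable (by norm_num)
  have i3 := (MemLp.mulVec (hR k) S.BR).integrable (by norm_num)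
  rw [show x (k + 1) = (fun ω => S.A *ᵥ x k ω) + (fun ω => S.BL *ᵥ uL k ω)
    + (fun ω => S.BR *ᵥ uR k ω) from funext (h.1.2 k)]
  have h3 := condExp_of_stronglyMeasurable (μ := μ) hle (h.2.2 k).stronglyMeasurable
    ((hR k).integrable (by norm_num))
  filter_upwards [condExp_add (i1.add i2) i3 (remoteSigma η x k),
    condExp_add i1 i2 (remoteSigma η x k),
    condExp_mulVec (m := remoteSigma η x k) (hx.integrable (by norm_num)) S.A,
    condExp_mulVec (m := remoteSigma η x k) ((hL k).integrable (by norm_num)) S.BL,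
    condExp_mulVec (m := remoteSigma η x k) ((hR k).integrable (by norm_num)) S.BR]
    with ω e1 e2 e3 e4 e5
  rw [e1, Pi.add_apply, e2, Pi.add_apply, e3, e4, e5, h3]
  rfl

/-- Propagation of the quadratic value through one use of the channel. -/
theorem IsAdmissible.expectedValue_succ_eq (h : S.IsAdmissible x0 η uL uR x)
    (hp0 : 0 ≤ S.p) (hset : IsSetting μ S.p x0 η)
    (hL : ∀ k, MemLp (uL k) 2 μ) (hR : ∀ k, MemLp (uR k) 2 μ) (k : ℕ)
    (Z X : Matrix (Fin n) (Fin n) ℝ) {a d : Ω → Fin n → ℝ}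
    (ha : a =ᵐ[μ] fun ω => S.A *ᵥ estimate μ η x k ω
      + S.BL *ᵥ (μ[uL k | remoteSigma η x k]) ω + S.BR *ᵥ uR k ω)
    (hd : d =ᵐ[μ] fun ω => S.A *ᵥ estError μ η x k ω
      + S.BL *ᵥ (uL k ω - (μ[uL k | remoteSigma η x k]) ω)) :
    expectedValue μ η x Z X (k + 1)
      = ∫ ω, a ω ⬝ᵥ Z *ᵥ a ω ∂μ + ∫ ω, d ω ⬝ᵥ S.Psi Z X *ᵥ d ω ∂μ := by
  have hc := h.condExp_succ hset hL hR k
  have hg : estimate μ η x (k + 1) =ᵐ[μ] μ[x (k + 1) | remoteSigma η x k ⊔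
      MeasurableSpace.comap (fun ω => received (η (k + 1) ω) (x (k + 1) ω)) inferInstance] := by
    rw [estimate, remoteSigma_succ]
  have := integral_quadratic_sup_received (h.remoteSigma_le_history k) (hset.history_le (k + 1))
    (hset.measurable_η (k + 1)) (hset.indep_history (k + 1)) (h.measurable_history (k + 1))
    (h.memLp hset hL hR (k + 1)) hp0 (hset.prob_loss (k + 1)) Z X hg
  rw [expectedValue]
  refine this.trans ?_
  congr 1
  · refine integral_congr_ae ?_
    filter_upwards [hc, ha] with ω h1 h2
    rw [h1, h2]
  · refine integral_congr_ae ?_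
    filter_upwards [hc, hd] with ω h1 h2
    -- The remote control is known to the estimator, so it cancels from the prediction error.
    have : x (k + 1) ω - (μ[x (k + 1) | remoteSigma η x k]) ω = d ω := by
      rw [h1, h2, h.1.2 k ω, estError, mulVec_sub, mulVec_sub]
      abel
    rw [this, Psi]

end NCS

namespace NCS

section Algebra

variable {n l r : ℕ} {S : NCS n l r}

/-- The joint control weight. -/
def blockR (S : NCS n l r) : Matrix (Fin l ⊕ Fin r) (Fin l ⊕ Fin r) ℝ :=
  Matrix.fromBlocks S.RL 0 0 S.RR

theorem dotProduct_blockR_mulVec (S : NCS n l r) (a : Fin l → ℝ) (b : Fin r → ℝ) :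
    Sum.elim a b ⬝ᵥ S.blockR *ᵥ Sum.elim a b = a ⬝ᵥ S.RL *ᵥ a + b ⬝ᵥ S.RR *ᵥ b := by
  simp [blockR, fromBlocks_mulVec, sumElim_dotProduct_sumElim]

theorem B_mulVec (S : NCS n l r) (a : Fin l → ℝ) (b : Fin r → ℝ) :
    S.B *ᵥ Sum.elim a b = S.BL *ᵥ a + S.BR *ᵥ b := by
  simp [B, fromCols_mulVec]

theorem posDef_blockR (hRL : S.RL.PosDef) (hRR : S.RR.PosDef) : S.blockR.PosDef := by
  refine PosDef.of_dotProduct_mulVec_pos ?_ fun v hv => ?_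
  · rw [blockR, IsHermitian, conjTranspose_eq_transpose_of_trivial, fromBlocks_transpose,
      hRL.isHermitian.transpose_eq, hRR.isHermitian.transpose_eq, transpose_zero, transpose_zero]
  · rw [star_trivial, ← Sum.elim_comp_inl_inr v, dotProduct_blockR_mulVec]
    have hL := hRL.posSemidef.dotProduct_mulVec_nonneg' (v ∘ Sum.inl)
    have hR := hRR.posSemidef.dotProduct_mulVec_nonneg' (v ∘ Sum.inr)
    by_cases h : v ∘ Sum.inl = 0
    · have h' : v ∘ Sum.inr ≠ 0 := fun h' => hv <| by
        rw [← Sum.elim_comp_inl_inr v, h, h']; ext i; cases i <;> rfl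
      exact add_pos_of_nonneg_of_pos hL (by simpa using hRR.dotProduct_mulVec_pos h')
    · exact add_pos_of_pos_of_nonneg (by simpa using hRL.dotProduct_mulVec_pos h) hR

theorem K_eq_riccatiGain (S : NCS n l r) (Z : Matrix (Fin n) (Fin n) ℝ) :
    S.K Z = riccatiGain S.A S.B S.blockR Z := by
  simp only [K, riccatiGain, Upsilon, blockR, Matrix.mul_assoc]

/-- Since `Υ` is symmetric and invertible when `Z ≥ 0`, the term `K' Υ K` is the `N' Υ⁻¹ N` of the
general Riccati map, with `N = B' Z A`. -/
theorem riccatiMap_Z (hRL : S.RL.PosDef) (hRR : S.RR.PosDef) {Z : Matrix (Fin n) (Fin n) ℝ}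
    (hZ : Z.PosSemidef) :
    S.Aᵀ * Z * S.A + S.Q - (S.K Z)ᵀ * S.Upsilon Z * S.K Z
      = riccatiMap S.A S.B S.Q S.blockR Z := by
  have hΥ : (S.Upsilon Z).PosDef := posDef_riccatiWeight (posDef_blockR hRL hRR) hZ
  have hdet : IsUnit (S.Upsilon Z).det := (Matrix.isUnit_iff_isUnit_det _).mp hΥ.isUnit
  have hK : S.K Z = (S.Upsilon Z)⁻¹ * (S.Bᵀ * Z * S.A) := by simp only [K, Matrix.mul_assoc]
  have h1 : S.Upsilon Z * S.K Z = S.Bᵀ * Z * S.A := by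
    rw [hK, mul_nonsing_inv_cancel_left _ _ hdet]
  have h2 : (S.K Z)ᵀ = (S.Bᵀ * Z * S.A)ᵀ * (S.Upsilon Z)⁻¹ := by
    rw [hK, transpose_mul, transpose_nonsing_inv, hΥ.isHermitian.transpose_eq]
  rw [Matrix.mul_assoc _ (S.Upsilon Z), h1, h2]
  rfl

end Algebra

variable {n l r : ℕ} {S : NCS n l r} {Ω : Type*} [MeasurableSpace Ω] {μ : Measure Ω}
  [IsProbabilityMeasure μ]
  {x0 : Ω → Fin n → ℝ} {η : ℕ → Ω → Bool} {uL : ℕ → Ω → Fin l → ℝ} {uR : ℕ → Ω → Fin r → ℝ}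
  {x : ℕ → Ω → Fin n → ℝ} {Z X : Matrix (Fin n) (Fin n) ℝ}

omit [IsProbabilityMeasure μ] in
theorem memLp_sumElim {f : Ω → Fin l → ℝ} {g : Ω → Fin r → ℝ} (hf : MemLp f 2 μ)
    (hg : MemLp g 2 μ) : MemLp (fun ω => Sum.elim (f ω) (g ω)) 2 μ := by
  have h := (MemLp.mulVec hf
      (fromRows (1 : Matrix (Fin l) (Fin l) ℝ) (0 : Matrix (Fin r) (Fin l) ℝ))).add
    (MemLp.mulVec hg (fromRows (0 : Matrix (Fin l) (Fin r) ℝ) (1 : Matrix (Fin r) (Fin r) ℝ)))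
  refine h.ae_eq (ae_of_all _ fun ω => ?_)
  ext i
  cases i <;> simp [fromRows_mulVec]

/-- Dynamic programming identity: the running cost plus the next value equals the current value
plus the squared deviations from the stationary controls. -/
theorem IsAdmissible.stageCost_add_expectedValue_succ (h : S.IsAdmissible x0 η uL uR x)
    (hp0 : 0 ≤ S.p) (hset : IsSetting μ S.p x0 η) (hRL : S.RL.PosDef) (hRR : S.RR.PosDef)
    (hZ : Z.PosSemidef) (hΨ : (S.Psi Z X).PosSemidef)
    (hfZ : Z = riccatiMap S.A S.B S.Q S.blockR Z)
    (hfX : X = riccatiMap S.A S.BL S.Q S.RL (S.Psi Z X))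
    (hL : ∀ k, MemLp (uL k) 2 μ) (hR : ∀ k, MemLp (uR k) 2 μ) (k : ℕ) :
    S.expectedStageCost μ uL uR x k + expectedValue μ η x Z X (k + 1)
      = expectedValue μ η x Z X k
        + ∫ ω, (Sum.elim ((μ[uL k | remoteSigma η x k]) ω) (uR k ω) + S.K Z *ᵥ estimate μ η x k ω)
            ⬝ᵥ S.Upsilon Z *ᵥ (Sum.elim ((μ[uL k | remoteSigma η x k]) ω) (uR k ω)
              + S.K Z *ᵥ estimate μ η x k ω) ∂μ
        + ∫ ω, (uL k ω - (μ[uL k | remoteSigma η x k]) ω + S.errorGain Z X *ᵥ estError μ η x k ω)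
            ⬝ᵥ S.Lambda Z X *ᵥ (uL k ω - (μ[uL k | remoteSigma η x k]) ω
              + S.errorGain Z X *ᵥ estError μ η x k ω) ∂μ := by
  have hle := (h.remoteSigma_le_history k).trans (hset.history_le (k + 1))
  have hx := h.memLp hset hL hR k
  have he : MemLp (estimate μ η x k) 2 μ := hx.condExp (by norm_num)
  have het : MemLp (estError μ η x k) 2 μ := hx.sub he
  have hu : MemLp (μ[uL k | remoteSigma η x k]) 2 μ := (hL k).condExp (by norm_num)
  have hut : MemLp (fun ω => uL k ω - (μ[uL k | remoteSigma η x k]) ω) 2 μ := (hL k).sub hu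
  have hU := memLp_sumElim hu (hR k)
  have hV := h.expectedValue_succ_eq hp0 hset hL hR k Z X (ae_eq_refl _) (ae_eq_refl _)
  -- Two independent squares: the joint control `(û, uR)` acts on the estimate with weight `Z`, and
  -- the residual `uL - û` acts on the error with weight `Ψ`.
  have c1 := integral_riccatiMap_completion (A := S.A) (B := S.B) (Q := S.Q)
    (posDef_blockR hRL hRR) hZ he hU
  have c2 := integral_riccatiMap_completion (A := S.A) (B := S.BL) (Q := S.Q) hRL hΨ het hut
  rw [← hfZ, ← K_eq_riccatiGain] at c1
  rw [← hfX] at c2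
  simp only [B_mulVec, dotProduct_blockR_mulVec, ← add_assoc] at c1
  rw [integral_add (integrable_dotProduct_mulVec hu hu _)
    (integrable_dotProduct_mulVec (hR k) (hR k) _)] at c1
  have d1 := integral_quadratic_eq_condExp_add_residual hle hx S.Q
  have d2 := integral_quadratic_eq_condExp_add_residual hle (hL k) S.RL
  have d3 : S.expectedStageCost μ uL uR x k = ∫ ω, x k ω ⬝ᵥ S.Q *ᵥ x k ω ∂μ
      + ∫ ω, uL k ω ⬝ᵥ S.RL *ᵥ uL k ω ∂μ + ∫ ω, uR k ω ⬝ᵥ S.RR *ᵥ uR k ω ∂μ := by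
    have i1 := integrable_dotProduct_mulVec hx hx S.Q
    have i2 := integrable_dotProduct_mulVec (hL k) (hL k) S.RL
    have i3 := integrable_dotProduct_mulVec (hR k) (hR k) S.RR
    rw [expectedStageCost, integral_add (i1.fun_add i2) i3, integral_add i1 i2]
  have d4 : expectedValue μ η x Z X k = ∫ ω, estimate μ η x k ω ⬝ᵥ Z *ᵥ estimate μ η x k ω ∂μ
      + ∫ ω, estError μ η x k ω ⬝ᵥ X *ᵥ estError μ η x k ω ∂μ :=
    integral_add (integrable_dotProduct_mulVec he he _) (integrable_dotProduct_mulVec het het _)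
  have d1' : ∫ ω, x k ω ⬝ᵥ S.Q *ᵥ x k ω ∂μ
      = ∫ ω, estimate μ η x k ω ⬝ᵥ S.Q *ᵥ estimate μ η x k ω ∂μ
        + ∫ ω, estError μ η x k ω ⬝ᵥ S.Q *ᵥ estError μ η x k ω ∂μ := d1
  have hΥ : S.Bᵀ * Z * S.B + S.blockR = S.Upsilon Z := rfl
  have hΛ : S.BLᵀ * S.Psi Z X * S.BL + S.RL = S.Lambda Z X := rfl
  have hg : riccatiGain S.A S.BL S.RL (S.Psi Z X) = S.errorGain Z X := rfl
  rw [hΥ] at c1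
  rw [hΛ, hg] at c2
  rw [d3, d4, hV, d1', d2]
  linarith

end NCS

/-! ### Square integrability, finite cost and the lower bound -/

section SecondMoments

variable {Ω : Type*} [MeasurableSpace Ω] {μ : Measure Ω} {ι : Type*} [Fintype ι]

theorem measurable_dotProduct_mulVec {f : Ω → ι → ℝ} (hf : Measurable f) (S : Matrix ι ι ℝ) :
    Measurable fun ω => f ω ⬝ᵥ S *ᵥ f ω := by
  have : Measurable fun v : ι → ℝ => v ⬝ᵥ S *ᵥ v :=
    (Continuous.dotProduct continuous_id (continuous_const.matrix_mulVec continuous_id)).measurable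
  exact this.comp hf

theorem measurable_dotProduct_self {f : Ω → ι → ℝ} (hf : Measurable f) :
    Measurable fun ω => f ω ⬝ᵥ f ω := by
  have : Measurable fun v : ι → ℝ => v ⬝ᵥ v :=
    (Continuous.dotProduct continuous_id continuous_id).measurable
  exact this.comp hf

theorem memLp_two_of_lintegral_dotProduct_ne_top {f : Ω → ι → ℝ} (hf : Measurable f)
    (h : ∫⁻ ω, ENNReal.ofReal (f ω ⬝ᵥ f ω) ∂μ ≠ ⊤) : MemLp f 2 μ := by
  have hi : Integrable (fun ω => f ω ⬝ᵥ f ω) μ :=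
    (lintegral_ofReal_ne_top_iff_integrable (measurable_dotProduct_self hf).aestronglyMeasurable
      (ae_of_all _ fun ω => dotProduct_self_nonneg' _)).mp h
  rw [memLp_two_iff_integrable_sq_norm hf.aestronglyMeasurable]
  refine hi.mono' (hf.norm.pow_const 2).aestronglyMeasurable (ae_of_all _ fun ω => ?_)
  rw [Real.norm_of_nonneg (by positivity)]
  have h0 := dotProduct_self_nonneg' (f ω)
  -- The norm on `ι → ℝ` is the sup norm, which the Euclidean one dominates.
  have hle : ‖f ω‖ ≤ √(f ω ⬝ᵥ f ω) := by
    refine (pi_norm_le_iff_of_nonneg (Real.sqrt_nonneg _)).mpr fun i => Real.le_sqrt_of_sq_le ?_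
    rw [Real.norm_eq_abs, sq_abs, sq]
    exact Finset.single_le_sum (f := fun i => f ω i * f ω i)
      (fun i _ => mul_self_nonneg (f ω i)) (Finset.mem_univ i)
  calc ‖f ω‖ ^ 2 ≤ √(f ω ⬝ᵥ f ω) ^ 2 := by gcongr
    _ = f ω ⬝ᵥ f ω := Real.sq_sqrt h0

theorem lintegral_dotProduct_self_eq {f : Ω → ι → ℝ} (hf : MemLp f 2 μ) :
    ∫⁻ ω, ENNReal.ofReal (f ω ⬝ᵥ f ω) ∂μ = ENNReal.ofReal (∫ ω, f ω ⬝ᵥ f ω ∂μ) :=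
  (ofReal_integral_eq_lintegral_ofReal (integrable_dotProduct hf hf)
    (ae_of_all _ fun _ => dotProduct_self_nonneg' _)).symm

theorem MSTendstoZero.tendsto_integral {f : ℕ → Ω → ι → ℝ} (hf : MSTendstoZero μ f)
    (hL : ∀ k, MemLp (f k) 2 μ) : Tendsto (fun k => ∫ ω, f k ω ⬝ᵥ f k ω ∂μ) atTop (𝓝 0) := by
  have h := (ENNReal.tendsto_toReal ENNReal.zero_ne_top).comp hf
  refine h.congr fun k => ?_
  simp only [Function.comp_apply]
  rw [lintegral_dotProduct_self_eq (hL k),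
    ENNReal.toReal_ofReal (integral_nonneg fun _ => dotProduct_self_nonneg' _)]

theorem integral_quadratic_nonneg {S : Matrix ι ι ℝ} (hS : S.PosSemidef) (f : Ω → ι → ℝ) :
    0 ≤ ∫ ω, f ω ⬝ᵥ S *ᵥ f ω ∂μ :=
  integral_nonneg fun _ => hS.dotProduct_mulVec_nonneg' _

end SecondMoments

namespace NCS

variable {n l r : ℕ} {S : NCS n l r} {Ω : Type*} [MeasurableSpace Ω] {μ : Measure Ω}
  {x0 : Ω → Fin n → ℝ} {η : ℕ → Ω → Bool} {uL : ℕ → Ω → Fin l → ℝ} {uR : ℕ → Ω → Fin r → ℝ}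
  {x : ℕ → Ω → Fin n → ℝ} {Z X : Matrix (Fin n) (Fin n) ℝ}

theorem upsilon_posSemidef (S : NCS n l r) (hRL : S.RL.PosDef) (hRR : S.RR.PosDef)
    (hZ : Z.PosSemidef) : (S.Upsilon Z).PosSemidef :=
  (posDef_riccatiWeight (B := S.B) (posDef_blockR hRL hRR) hZ).posSemidef

theorem lambda_posSemidef (S : NCS n l r) (hRL : S.RL.PosDef) (hΨ : (S.Psi Z X).PosSemidef) :
    (S.Lambda Z X).PosSemidef :=
  (posDef_riccatiWeight (B := S.BL) hRL hΨ).posSemidef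

theorem IsAdmissible.measurable {p : ℝ} (h : S.IsAdmissible x0 η uL uR x)
    (hset : IsSetting μ p x0 η) (k : ℕ) :
    Measurable (x k) ∧ Measurable (uL k) ∧ Measurable (uR k) :=
  ⟨(h.measurable_history k).mono (hset.history_le k) le_rfl,
    (h.2.1 k).mono ((h.localSigma_le_history k).trans (hset.history_le _)) le_rfl,
    (h.2.2 k).mono ((h.remoteSigma_le_history k).trans (hset.history_le _)) le_rfl⟩

theorem IsAdmissible.cost_eq_tsum {p : ℝ} (h : S.IsAdmissible x0 η uL uR x)
    (hset : IsSetting μ p x0 η) :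
    S.cost μ uL uR x = ∑' k, ∫⁻ ω, ENNReal.ofReal (x k ω ⬝ᵥ S.Q *ᵥ x k ω
      + uL k ω ⬝ᵥ S.RL *ᵥ uL k ω + uR k ω ⬝ᵥ S.RR *ᵥ uR k ω) ∂μ := by
  refine lintegral_tsum fun k => ?_
  obtain ⟨h1, h2, h3⟩ := h.measurable hset k
  exact (((measurable_dotProduct_mulVec h1 _).add (measurable_dotProduct_mulVec h2 _)).add
    (measurable_dotProduct_mulVec h3 _)).ennreal_ofReal.aemeasurable

/-- A vector whose square is dominated by the running cost is square integrable and tends to zero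
in mean square whenever the cost is finite. -/
theorem IsAdmissible.lintegral_of_le_stageCost {p : ℝ} (h : S.IsAdmissible x0 η uL uR x)
    (hset : IsSetting μ p x0 η) (hfin : S.cost μ uL uR x ≠ ⊤) {a : ℕ} {f : ℕ → Ω → Fin a → ℝ}
    {c : ℝ} (hc : 0 ≤ c) (hf : ∀ k ω, f k ω ⬝ᵥ f k ω ≤ c * (x k ω ⬝ᵥ S.Q *ᵥ x k ω
      + uL k ω ⬝ᵥ S.RL *ᵥ uL k ω + uR k ω ⬝ᵥ S.RR *ᵥ uR k ω)) :
    (∀ k, ∫⁻ ω, ENNReal.ofReal (f k ω ⬝ᵥ f k ω) ∂μ ≠ ⊤) ∧ MSTendstoZero μ f := by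
  rw [h.cost_eq_tsum hset] at hfin
  have hle (k : ℕ) : ∫⁻ ω, ENNReal.ofReal (f k ω ⬝ᵥ f k ω) ∂μ ≤ ENNReal.ofReal c *
      ∫⁻ ω, ENNReal.ofReal (x k ω ⬝ᵥ S.Q *ᵥ x k ω
        + uL k ω ⬝ᵥ S.RL *ᵥ uL k ω + uR k ω ⬝ᵥ S.RR *ᵥ uR k ω) ∂μ := by
    rw [← lintegral_const_mul' _ _ ENNReal.ofReal_ne_top]
    refine lintegral_mono fun ω => ?_
    dsimp only
    rw [← ENNReal.ofReal_mul hc]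
    exact ENNReal.ofReal_le_ofReal (hf k ω)
  refine ⟨fun k => ne_top_of_le_ne_top (ENNReal.mul_ne_top ENNReal.ofReal_ne_top
    (ENNReal.ne_top_of_tsum_ne_top hfin k)) (hle k), ?_⟩
  have h1 := ENNReal.Tendsto.const_mul (a := ENNReal.ofReal c)
    (ENNReal.tendsto_atTop_zero_of_tsum_ne_top hfin) (Or.inr ENNReal.ofReal_ne_top)
  rw [mul_zero] at h1
  exact tendsto_of_tendsto_of_tendsto_of_le_of_le tendsto_const_nhds h1 (fun _ => zero_le) hle

/-- Finite cost forces square integrable controls and a state that tends to zero. -/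
theorem IsAdmissible.of_cost_ne_top {p : ℝ} (h : S.IsAdmissible x0 η uL uR x)
    (hset : IsSetting μ p x0 η) (hRL : S.RL.PosDef) (hRR : S.RR.PosDef) (hQ : S.Q.PosSemidef)
    (hobs : Observable S.A (CFC.sqrt S.Q)) (hfin : S.cost μ uL uR x ≠ ⊤) :
    (∀ k, MemLp (uL k) 2 μ) ∧ (∀ k, MemLp (uR k) 2 μ) ∧ MSTendstoZero μ x := by
  have nQ (k ω) := hQ.dotProduct_mulVec_nonneg' (x k ω)
  have nL (k ω) := hRL.posSemidef.dotProduct_mulVec_nonneg' (uL k ω)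
  have nR (k ω) := hRR.posSemidef.dotProduct_mulVec_nonneg' (uR k ω)
  obtain ⟨cL, hcL, hL⟩ := hRL.exists_le_quadratic
  obtain ⟨cR, hcR, hR⟩ := hRR.exists_le_quadratic
  obtain ⟨l1, l2⟩ := h.lintegral_of_le_stageCost hset hfin (f := uL) hcL fun k ω =>
    (hL _).trans (mul_le_mul_of_nonneg_left (by linarith [nQ k ω, nR k ω]) hcL)
  obtain ⟨r1, r2⟩ := h.lintegral_of_le_stageCost hset hfin (f := uR) hcR fun k ω =>
    (hR _).trans (mul_le_mul_of_nonneg_left (by linarith [nQ k ω, nL k ω]) hcR)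
  obtain ⟨-, q2⟩ := h.lintegral_of_le_stageCost hset hfin
    (f := fun k ω => CFC.sqrt S.Q *ᵥ x k ω) zero_le_one fun k ω => by
      rw [dotProduct_sqrt_mulVec_self hQ]; linarith [nL k ω, nR k ω]
  have hmul {a b : ℕ} (M : Matrix (Fin a) (Fin b) ℝ) : Measurable fun v : Fin b → ℝ => M *ᵥ v :=
    (LinearMap.toContinuousLinearMap M.mulVecLin).continuous.measurable
  refine ⟨fun k => memLp_two_of_lintegral_dotProduct_ne_top (h.measurable hset k).2.1 (l1 k),
    fun k => memLp_two_of_lintegral_dotProduct_ne_top (h.measurable hset k).2.2 (r1 k), ?_⟩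
  exact MSTendstoZero.of_observable hobs (fun k ω => by rw [h.1.2 k ω, add_assoc])
    (fun k => (h.measurable hset k).1) ((l2.mulVec S.BL).add (r2.mulVec S.BR)
      fun k => (hmul _).comp (h.measurable hset k).2.1) q2

theorem expectedValue_nonneg (hZ : Z.PosSemidef) (hX : X.PosSemidef) (k : ℕ) :
    0 ≤ expectedValue μ η x Z X k :=
  integral_nonneg fun _ => add_nonneg (hZ.dotProduct_mulVec_nonneg' _)
    (hX.dotProduct_mulVec_nonneg' _)

theorem IsAdmissible.cost_eq_tsum_expectedStageCost (h : S.IsAdmissible x0 η uL uR x)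
    (hset : IsSetting μ S.p x0 η) (hRL : S.RL.PosDef) (hRR : S.RR.PosDef) (hQ : S.Q.PosSemidef)
    (hL : ∀ k, MemLp (uL k) 2 μ) (hR : ∀ k, MemLp (uR k) 2 μ) :
    S.cost μ uL uR x = ∑' k, ENNReal.ofReal (S.expectedStageCost μ uL uR x k) := by
  rw [h.cost_eq_tsum hset]
  refine tsum_congr fun k => (ofReal_integral_eq_lintegral_ofReal ?_ (ae_of_all _ fun ω => ?_)).symm
  · have hx := h.memLp hset hL hR k
    exact ((integrable_dotProduct_mulVec hx hx _).add
      (integrable_dotProduct_mulVec (hL k) (hL k) _)).add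
      (integrable_dotProduct_mulVec (hR k) (hR k) _)
  · exact add_nonneg (add_nonneg (hQ.dotProduct_mulVec_nonneg' _)
      (hRL.posSemidef.dotProduct_mulVec_nonneg' _)) (hRR.posSemidef.dotProduct_mulVec_nonneg' _)

theorem expectedStageCost_nonneg (hRL : S.RL.PosDef) (hRR : S.RR.PosDef) (hQ : S.Q.PosSemidef)
    (k : ℕ) : 0 ≤ S.expectedStageCost μ uL uR x k :=
  integral_nonneg fun _ => add_nonneg (add_nonneg (hQ.dotProduct_mulVec_nonneg' _)
    (hRL.posSemidef.dotProduct_mulVec_nonneg' _)) (hRR.posSemidef.dotProduct_mulVec_nonneg' _)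

variable [IsProbabilityMeasure μ]

/-- Adding the nonnegative terms `x̃' Z x̃` and `x̂' X x̂` bounds the value by `E x' (Z + X) x`,
hence by a multiple of `E x' x`. -/
theorem IsAdmissible.tendsto_expectedValue {p : ℝ} (h : S.IsAdmissible x0 η uL uR x)
    (hset : IsSetting μ p x0 η) (hZ : Z.PosSemidef) (hX : X.PosSemidef)
    (hL : ∀ k, MemLp (x k) 2 μ) (hx : MSTendstoZero μ x) :
    Tendsto (expectedValue μ η x Z X) atTop (𝓝 0) := by
  obtain ⟨c, hc, hle⟩ := exists_quadratic_le (Z + X)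
  have h1 := (hx.tendsto_integral hL).const_mul c
  rw [mul_zero] at h1
  refine squeeze_zero (fun k => expectedValue_nonneg hZ hX k) (fun k => ?_) h1
  have hm := (h.remoteSigma_le_history k).trans (hset.history_le (k + 1))
  have he : MemLp (estimate μ η x k) 2 μ := (hL k).condExp (by norm_num)
  have het : MemLp (estError μ η x k) 2 μ := (hL k).sub he
  have d4 : expectedValue μ η x Z X k = ∫ ω, estimate μ η x k ω ⬝ᵥ Z *ᵥ estimate μ η x k ω ∂μ
      + ∫ ω, estError μ η x k ω ⬝ᵥ X *ᵥ estError μ η x k ω ∂μ :=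
    integral_add (integrable_dotProduct_mulVec he he _) (integrable_dotProduct_mulVec het het _)
  have dZ : ∫ ω, x k ω ⬝ᵥ Z *ᵥ x k ω ∂μ = ∫ ω, estimate μ η x k ω ⬝ᵥ Z *ᵥ estimate μ η x k ω ∂μ
      + ∫ ω, estError μ η x k ω ⬝ᵥ Z *ᵥ estError μ η x k ω ∂μ :=
    integral_quadratic_eq_condExp_add_residual hm (hL k) Z
  have dX : ∫ ω, x k ω ⬝ᵥ X *ᵥ x k ω ∂μ = ∫ ω, estimate μ η x k ω ⬝ᵥ X *ᵥ estimate μ η x k ω ∂μ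
      + ∫ ω, estError μ η x k ω ⬝ᵥ X *ᵥ estError μ η x k ω ∂μ :=
    integral_quadratic_eq_condExp_add_residual hm (hL k) X
  have n1 : 0 ≤ ∫ ω, estError μ η x k ω ⬝ᵥ Z *ᵥ estError μ η x k ω ∂μ :=
    integral_nonneg fun _ => hZ.dotProduct_mulVec_nonneg' _
  have n2 : 0 ≤ ∫ ω, estimate μ η x k ω ⬝ᵥ X *ᵥ estimate μ η x k ω ∂μ :=
    integral_nonneg fun _ => hX.dotProduct_mulVec_nonneg' _
  have hsum : ∫ ω, x k ω ⬝ᵥ Z *ᵥ x k ω ∂μ + ∫ ω, x k ω ⬝ᵥ X *ᵥ x k ω ∂μ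
      ≤ c * ∫ ω, x k ω ⬝ᵥ x k ω ∂μ := by
    rw [← integral_add (integrable_dotProduct_mulVec (hL k) (hL k) _)
      (integrable_dotProduct_mulVec (hL k) (hL k) _), ← integral_const_mul]
    refine integral_mono ((integrable_dotProduct_mulVec (hL k) (hL k) _).add
      (integrable_dotProduct_mulVec (hL k) (hL k) _))
      ((integrable_dotProduct (hL k) (hL k)).const_mul c) fun ω => ?_
    have := hle (x k ω)
    simpa [add_mulVec, dotProduct_add] using this
  linarith

/-- The value of the Riccati solution bounds the cost of every admissible control from below. -/
theorem IsAdmissible.expectedValue_le_cost (h : S.IsAdmissible x0 η uL uR x)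
    (hp0 : 0 ≤ S.p) (hset : IsSetting μ S.p x0 η) (hRL : S.RL.PosDef) (hRR : S.RR.PosDef)
    (hQ : S.Q.PosSemidef) (hobs : Observable S.A (CFC.sqrt S.Q))
    (hZ : Z.PosSemidef) (hX : X.PosSemidef) (hΨ : (S.Psi Z X).PosSemidef)
    (hfZ : Z = riccatiMap S.A S.B S.Q S.blockR Z)
    (hfX : X = riccatiMap S.A S.BL S.Q S.RL (S.Psi Z X)) :
    ENNReal.ofReal (expectedValue μ η x Z X 0) ≤ S.cost μ uL uR x := by
  by_cases hfin : S.cost μ uL uR x = ⊤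
  · rw [hfin]; exact le_top
  obtain ⟨hL, hR, hx⟩ := h.of_cost_ne_top hset hRL hRR hQ hobs hfin
  have hstep (k : ℕ) : expectedValue μ η x Z X k - expectedValue μ η x Z X (k + 1)
      ≤ S.expectedStageCost μ uL uR x k := by
    have := h.stageCost_add_expectedValue_succ hp0 hset hRL hRR hZ hΨ hfZ hfX hL hR k
    have n1 := integral_quadratic_nonneg (μ := μ) (S.upsilon_posSemidef hRL hRR hZ) fun ω =>
      Sum.elim ((μ[uL k | remoteSigma η x k]) ω) (uR k ω) + S.K Z *ᵥ estimate μ η x k ω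
    have n2 := integral_quadratic_nonneg (μ := μ) (S.lambda_posSemidef hRL hΨ) fun ω =>
      uL k ω - (μ[uL k | remoteSigma η x k]) ω + S.errorGain Z X *ᵥ estError μ η x k ω
    linarith
  have hlim := (h.tendsto_expectedValue hset hZ hX (h.memLp hset hL hR) hx).const_sub
    (expectedValue μ η x Z X 0)
  rw [sub_zero] at hlim
  -- Each partial cost is at least the initial value minus the value at time `N`, and the latter
  -- tends to zero.
  refine le_of_tendsto' ((ENNReal.continuous_ofReal.tendsto _).comp hlim) fun N => ?_
  rw [h.cost_eq_tsum_expectedStageCost hset hRL hRR hQ hL hR]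
  refine le_trans ?_ (ENNReal.sum_le_tsum (Finset.range N))
  rw [← ENNReal.ofReal_sum_of_nonneg fun k _ => expectedStageCost_nonneg hRL hRR hQ k]
  refine ENNReal.ofReal_le_ofReal ?_
  dsimp only
  rw [← Finset.sum_range_sub' (expectedValue μ η x Z X) N]
  exact Finset.sum_le_sum fun k _ => hstep k

omit [IsProbabilityMeasure μ] in
-- The local controller can reconstruct the current state from `x 0` and the signals by running the
-- recursion; this makes the error feedback admissible.
theorem isAdmissible_closedLoop (S : NCS n l r) (μ : Measure Ω) (x0 : Ω → Fin n → ℝ)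
    (η : ℕ → Ω → Bool) (K1 : Matrix (Fin r) (Fin n) ℝ) (K2 L : Matrix (Fin l) (Fin n) ℝ) :
    S.IsAdmissible x0 η (localFeedback μ η K2 L (S.closedLoop μ x0 η K1 K2 L))
      (remoteFeedback μ η K1 (S.closedLoop μ x0 η K1 K2 L)) (S.closedLoop μ x0 η K1 K2 L) := by
  have htraj := S.closedLoop_isTrajectory μ x0 η K1 K2 L
  set x := S.closedLoop μ x0 η K1 K2 L
  have hmul {a b : ℕ} (M : Matrix (Fin a) (Fin b) ℝ) : Measurable fun v : Fin b → ℝ => M *ᵥ v :=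
    (LinearMap.toContinuousLinearMap M.mulVecLin).continuous.measurable
  have he (k : ℕ) : Measurable[remoteSigma η x k] (estimate μ η x k) :=
    stronglyMeasurable_condExp.measurable
  have he' (k : ℕ) : Measurable[localSigma η x k] (estimate μ η x k) :=
    (he k).mono le_sup_right le_rfl
  have hR (k : ℕ) : Measurable[remoteSigma η x k] (remoteFeedback μ η K1 x k) :=
    ((hmul K1).comp (he k)).neg
  have hL (k : ℕ) (hx : Measurable[localSigma η x k] (x k)) :
      Measurable[localSigma η x k] (localFeedback μ η K2 L x k) :=
    ((hmul K2).comp (he' k)).neg.sub ((hmul L).comp (hx.sub (he' k)))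
  have hx (k : ℕ) : Measurable[localSigma η x k] (x k) := by
    induction k with
    | zero => exact (comap_measurable (x 0)).mono le_sup_left le_rfl
    | succ k ih =>
      rw [show x (k + 1) = fun ω => S.A *ᵥ x k ω + S.BL *ᵥ localFeedback μ η K2 L x k ω
        + S.BR *ᵥ remoteFeedback μ η K1 x k ω from funext (htraj.2 k)]
      exact ((((hmul S.A).comp ih).add ((hmul S.BL).comp (hL k ih))).add
        ((hmul S.BR).comp ((hR k).mono le_sup_right le_rfl))).mono
          (localSigma_mono (Nat.le_succ k)) le_rfl
  exact ⟨htraj, fun k => hL k (hx k), hR⟩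

omit [IsProbabilityMeasure μ] in
/-- Closed-loop states and feedbacks are square integrable. -/
theorem memLp_closedLoop {p : ℝ} (hset : IsSetting μ p x0 η) (S : NCS n l r)
    (K1 : Matrix (Fin r) (Fin n) ℝ) (K2 L : Matrix (Fin l) (Fin n) ℝ) (k : ℕ) :
    MemLp (S.closedLoop μ x0 η K1 K2 L k) 2 μ ∧
    MemLp (localFeedback μ η K2 L (S.closedLoop μ x0 η K1 K2 L) k) 2 μ ∧
    MemLp (remoteFeedback μ η K1 (S.closedLoop μ x0 η K1 K2 L) k) 2 μ := by
  have htraj := S.closedLoop_isTrajectory μ x0 η K1 K2 L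
  set x := S.closedLoop μ x0 η K1 K2 L
  have hfb (k : ℕ) (hx : MemLp (x k) 2 μ) : MemLp (localFeedback μ η K2 L x k) 2 μ ∧
      MemLp (remoteFeedback μ η K1 x k) 2 μ := by
    have he : MemLp (estimate μ η x k) 2 μ := hx.condExp (by norm_num)
    exact ⟨(MemLp.mulVec he K2).neg.sub (MemLp.mulVec (hx.sub he) L), (MemLp.mulVec he K1).neg⟩
  have hx : MemLp (x k) 2 μ := by
    induction k with
    | zero => rw [htraj.1]; exact hset.memLp_x0
    | succ k ih =>
      rw [show x (k + 1) = fun ω => S.A *ᵥ x k ω + S.BL *ᵥ localFeedback μ η K2 L x k ω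
        + S.BR *ᵥ remoteFeedback μ η K1 x k ω from funext (htraj.2 k)]
      exact ((MemLp.mulVec ih S.A).add (MemLp.mulVec (hfb k ih).1 S.BL)).add
        (MemLp.mulVec (hfb k ih).2 S.BR)
  exact ⟨hx, hfb k hx⟩

theorem condExp_localFeedback {k : ℕ} (hm : remoteSigma η x k ≤ (inferInstance : MeasurableSpace Ω))
    (hx : MemLp (x k) 2 μ) (K2 L : Matrix (Fin l) (Fin n) ℝ) :
    μ[localFeedback μ η K2 L x k | remoteSigma η x k] =ᵐ[μ]
      fun ω => -(K2 *ᵥ estimate μ η x k ω) := by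
  have he : MemLp (estimate μ η x k) 2 μ := hx.condExp (by norm_num)
  have het : MemLp (estError μ η x k) 2 μ := hx.sub he
  have i1 := (MemLp.mulVec he K2).neg.integrable (by norm_num)
  have i2 := (MemLp.mulVec het L).integrable (by norm_num)
  have h0 : μ[estError μ η x k | remoteSigma η x k] =ᵐ[μ] 0 :=
    condExp_residual_eq_zero hm (hx.integrable (by norm_num))
  have hsm : StronglyMeasurable[remoteSigma η x k] (-fun ω => K2 *ᵥ estimate μ η x k ω) :=
    ((LinearMap.toContinuousLinearMap K2.mulVecLin).continuous.comp_stronglyMeasurable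
      stronglyMeasurable_condExp).neg
  have h1 := condExp_of_stronglyMeasurable hm hsm i1
  rw [show localFeedback μ η K2 L x k = (-fun ω => K2 *ᵥ estimate μ η x k ω)
    - fun ω => L *ᵥ estError μ η x k ω from rfl]
  filter_upwards [condExp_sub i1 i2 (remoteSigma η x k),
    condExp_mulVec_eq_zero (het.integrable (by norm_num)) h0 L] with ω e1 e2
  rw [e1, Pi.sub_apply, e2, h1]
  simp

/-- The stationary controls attain the value of the Riccati solution at most. -/
theorem cost_closedLoop_le (hp0 : 0 ≤ S.p) (hset : IsSetting μ S.p x0 η) (hRL : S.RL.PosDef)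
    (hRR : S.RR.PosDef) (hQ : S.Q.PosSemidef)
    (hZ : Z.PosSemidef) (hX : X.PosSemidef) (hΨ : (S.Psi Z X).PosSemidef)
    (hfZ : Z = riccatiMap S.A S.B S.Q S.blockR Z)
    (hfX : X = riccatiMap S.A S.BL S.Q S.RL (S.Psi Z X))
    (hx : x = S.closedLoop μ x0 η (S.remoteGain Z) (S.localGain Z) (S.errorGain Z X)) :
    S.cost μ (localFeedback μ η (S.localGain Z) (S.errorGain Z X) x)
      (remoteFeedback μ η (S.remoteGain Z) x) x ≤ ENNReal.ofReal (expectedValue μ η x Z X 0) := by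
  have hadm := S.isAdmissible_closedLoop μ x0 η (S.remoteGain Z) (S.localGain Z) (S.errorGain Z X)
  have hmem := memLp_closedLoop hset S (S.remoteGain Z) (S.localGain Z) (S.errorGain Z X)
  rw [← hx] at hadm hmem
  have hL := fun k => (hmem k).2.1
  have hR := fun k => (hmem k).2.2
  have hstep (k : ℕ) : S.expectedStageCost μ (localFeedback μ η (S.localGain Z) (S.errorGain Z X) x)
      (remoteFeedback μ η (S.remoteGain Z) x) x k
        = expectedValue μ η x Z X k - expectedValue μ η x Z X (k + 1) := by
    have h := hadm.stageCost_add_expectedValue_succ hp0 hset hRL hRR hZ hΨ hfZ hfX hL hR k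
    have hm := (hadm.remoteSigma_le_history k).trans (hset.history_le (k + 1))
    have hc := condExp_localFeedback hm (hmem k).1 (S.localGain Z) (S.errorGain Z X)
    -- Under the stationary gains both completed squares vanish almost surely, so the running cost
    -- is exactly the decrease of the value.
    have z1 : ∀ᵐ ω ∂μ, Sum.elim
        ((μ[localFeedback μ η (S.localGain Z) (S.errorGain Z X) x k | remoteSigma η x k]) ω)
        (remoteFeedback μ η (S.remoteGain Z) x k ω) + S.K Z *ᵥ estimate μ η x k ω = 0 := by
      filter_upwards [hc] with ω hω
      rw [hω]
      ext i
      cases i <;> simp [remoteFeedback, localGain, remoteGain, mulVec, toRows₁, toRows₂, dotProduct]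
    have z2 : ∀ᵐ ω ∂μ, localFeedback μ η (S.localGain Z) (S.errorGain Z X) x k ω
        - (μ[localFeedback μ η (S.localGain Z) (S.errorGain Z X) x k | remoteSigma η x k]) ω
        + S.errorGain Z X *ᵥ estError μ η x k ω = 0 := by
      filter_upwards [hc] with ω hω
      rw [hω, localFeedback]
      abel
    rw [integral_eq_zero_of_ae (by filter_upwards [z1] with ω h0; simp [h0]),
      integral_eq_zero_of_ae (by filter_upwards [z2] with ω h0; simp [h0])] at h
    linarith
  rw [hadm.cost_eq_tsum_expectedStageCost hset hRL hRR hQ hL hR]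
  refine ENNReal.tsum_le_of_sum_range_le fun N => ?_
  rw [← ENNReal.ofReal_sum_of_nonneg fun k _ => expectedStageCost_nonneg hRL hRR hQ k]
  refine ENNReal.ofReal_le_ofReal ?_
  simp_rw [hstep]
  rw [Finset.sum_range_sub']
  linarith [expectedValue_nonneg (μ := μ) (η := η) (x := x) hZ hX N]

end NCS

/-! ### Gaussian test settings -/

section Existence

/-- A standard normal variable and independent coin flips on a product space. With mean `v` and
covariance `w w'` chosen freely, these initial values probe `Z` and `Ψ` separately. -/
theorem exists_isSetting {n : ℕ} {p : ℝ} (hp0 : 0 ≤ p) (hp1 : p ≤ 1) (v w : Fin n → ℝ) :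
    ∃ (Ω : Type) (_ : MeasurableSpace Ω) (μ : Measure Ω) (_ : IsProbabilityMeasure μ) (g : Ω → ℝ)
      (η : ℕ → Ω → Bool), MemLp g 2 μ ∧ ∫ ω, g ω ∂μ = 0 ∧ ∫ ω, g ω ^ 2 ∂μ = 1 ∧
        IsSetting μ p (fun ω => v + g ω • w) η := by
  let ν : Measure Bool := ENNReal.ofReal p • Measure.dirac false
    + ENNReal.ofReal (1 - p) • Measure.dirac true
  have hν : IsProbabilityMeasure ν := ⟨by
    simp [ν, ← ENNReal.ofReal_add hp0 (sub_nonneg.mpr hp1)]⟩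
  let P : Measure (ℕ → Bool) := Measure.infinitePi fun _ => ν
  let μ : Measure (ℝ × (ℕ → Bool)) := (gaussianReal 0 1).prod P
  have hfst : μ.map Prod.fst = gaussianReal 0 1 := by simp [μ]
  have hsnd : μ.map Prod.snd = P := by simp [μ]
  have hηm (k : ℕ) : Measurable fun ω : ℝ × (ℕ → Bool) => ω.2 k :=
    (measurable_pi_apply k).comp measurable_snd
  have hηmap (k : ℕ) : μ.map (fun ω => ω.2 k) = ν := by
    rw [show (fun ω : ℝ × (ℕ → Bool) => ω.2 k) = Function.eval k ∘ Prod.snd from rfl,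
      ← Measure.map_map (measurable_pi_apply k) measurable_snd, hsnd]
    exact Measure.infinitePi_map_eval _ k
  have hid : MemLp (id : ℝ → ℝ) 2 (gaussianReal 0 1) := IsGaussian.memLp_two_id
  have hvar := variance_id_gaussianReal (μ := 0) (v := 1)
  have hmean := integral_id_gaussianReal (μ := 0) (v := 1)
  refine ⟨ℝ × (ℕ → Bool), inferInstance, μ, inferInstance, Prod.fst, fun k ω => ω.2 k,
    ?_, ?_, ?_, ?_⟩
  · rw [← hfst] at hid
    exact (memLp_map_measure_iff aestronglyMeasurable_id measurable_fst.aemeasurable).mp hid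
  · rw [← hfst, integral_map measurable_fst.aemeasurable (by fun_prop)] at hmean
    exact hmean
  · rw [variance_eq_sub hid] at hvar
    simp only [id_eq] at hvar
    rw [hmean] at hvar
    simp only [Pi.pow_apply, id_eq, ne_eq, OfNat.ofNat_ne_zero, not_false_eq_true, zero_pow,
      sub_zero, NNReal.coe_one] at hvar
    rw [← hfst, integral_map measurable_fst.aemeasurable (by fun_prop)] at hvar
    exact hvar
  · refine ⟨by fun_prop, ?_, hηm, fun k => ?_, ?_, ?_⟩
    · have h1 : μ.map (fun ω => v + ω.1 • w) = ((gaussianReal 0 1).map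
          (ContinuousLinearMap.smulRight (1 : ℝ →L[ℝ] ℝ) w)).map (fun y => v + y) := by
        rw [← hfst, Measure.map_map (by fun_prop) (by fun_prop),
          Measure.map_map (by fun_prop) (by fun_prop)]
        rfl
      rw [h1]
      infer_instance
    · have h1 : μ.map (fun ω => ω.2 k) {false} = ENNReal.ofReal p := by
        rw [hηmap]; simp [ν]
      rw [Measure.map_apply (hηm k) (MeasurableSet.singleton _)] at h1
      exact h1
    · rw [iIndepFun_iff_map_fun_eq_infinitePi_map hηm]
      simp_rw [hηmap]
      exact hsnd
    · exact indepFun_prod (X := fun t : ℝ => v + t • w) (Y := fun y : ℕ → Bool => y)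
        (by fun_prop) measurable_id

end Existence

/-! ### Initial values, decay under stabilizing gains, and Riccati solutions -/

namespace NCS

variable {n l r : ℕ} {S : NCS n l r} {Ω : Type*} [MeasurableSpace Ω] {μ : Measure Ω}
  [IsProbabilityMeasure μ]
  {x0 : Ω → Fin n → ℝ} {η : ℕ → Ω → Bool}
  {x : ℕ → Ω → Fin n → ℝ} {Z X : Matrix (Fin n) (Fin n) ℝ}

omit [IsProbabilityMeasure μ] in
theorem IsSetting.remoteSigma_zero_le {p : ℝ} (hset : IsSetting μ p x0 η) (h0 : x 0 = x0) :
    remoteSigma η x 0 ≤ (inferInstance : MeasurableSpace Ω) := by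
  refine le_sup_right.trans ((localSigma_le_history h0 (k := 0) fun j hj => ?_).trans
    (hset.history_le 1))
  rw [Nat.le_zero.mp hj, h0]
  exact (comap_measurable x0).mono le_sup_left le_rfl

/-- Write `x0 = x̂ + x̃`; the mixed terms have zero expectation by orthogonality. Only the signal at
time zero enters, so any process started at `x0` will do. -/
theorem initialValue_eq_expectedValue {p : ℝ} (hset : IsSetting μ p x0 η) (h0 : x 0 = x0) :
    initialValue μ x0 η Z X = expectedValue μ η x Z X 0 := by
  have hσ : remoteSigma η (fun _ => x0) 0 = remoteSigma η x 0 := by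
    rw [remoteSigma_zero, remoteSigma_zero, h0]
  have he : estimate μ η (fun _ => x0) 0 = estimate μ η x 0 := by
    rw [estimate, estimate, hσ, h0]
  have hee : estError μ η (fun _ => x0) 0 = estError μ η x 0 := by
    unfold estError; rw [he, h0]
  have hm := IsSetting.remoteSigma_zero_le hset h0
  have hx : MemLp (x 0) 2 μ := h0 ▸ hset.memLp_x0
  have hE : MemLp (estimate μ η x 0) 2 μ := hx.condExp (by norm_num)
  have hT : MemLp (estError μ η x 0) 2 μ := hx.sub hE
  have hT0 : μ[estError μ η x 0 | remoteSigma η x 0] =ᵐ[μ] 0 :=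
    condExp_residual_eq_zero hm (hx.integrable (by norm_num))
  have hEm : StronglyMeasurable[remoteSigma η x 0] (estimate μ η x 0) := stronglyMeasurable_condExp
  have hmul (M : Matrix (Fin n) (Fin n) ℝ) : StronglyMeasurable[remoteSigma η x 0]
      fun ω => M *ᵥ estimate μ η x 0 ω :=
    (LinearMap.toContinuousLinearMap M.mulVecLin).continuous.comp_stronglyMeasurable hEm
  have o1 : ∫ ω, estError μ η x 0 ω ⬝ᵥ Z *ᵥ estimate μ η x 0 ω ∂μ = 0 := by
    simp_rw [dotProduct_comm (estError μ η x 0 _)]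
    exact integral_dotProduct_eq_zero_of_condExp hm (hmul Z) (MemLp.mulVec hE Z) hT hT0
  have o2 : ∫ ω, estimate μ η x 0 ω ⬝ᵥ X *ᵥ estError μ η x 0 ω ∂μ = 0 :=
    integral_dotProduct_eq_zero_of_condExp hm hEm hE (MemLp.mulVec hT X)
      (condExp_mulVec_eq_zero (hT.integrable (by norm_num)) hT0 X)
  have i1 := integrable_dotProduct_mulVec hE hE Z
  have i2 := integrable_dotProduct_mulVec hT hT X
  have i3 := integrable_dotProduct_mulVec hT hE Z
  have i4 := integrable_dotProduct_mulVec hE hT X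
  have e (ω : Ω) : x0 ω ⬝ᵥ Z *ᵥ estimate μ η x 0 ω + x0 ω ⬝ᵥ X *ᵥ estError μ η x 0 ω
      = (estimate μ η x 0 ω ⬝ᵥ Z *ᵥ estimate μ η x 0 ω
          + estError μ η x 0 ω ⬝ᵥ X *ᵥ estError μ η x 0 ω)
        + (estError μ η x 0 ω ⬝ᵥ Z *ᵥ estimate μ η x 0 ω
          + estimate μ η x 0 ω ⬝ᵥ X *ᵥ estError μ η x 0 ω) := by
    have : x0 ω = estimate μ η x 0 ω + estError μ η x 0 ω := by
      rw [estError, h0, add_sub_cancel]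
    rw [this, add_dotProduct, add_dotProduct]
    ring
  rw [initialValue, he, hee, expectedValue]
  simp_rw [e]
  rw [integral_add (i1.fun_add i2) (i3.fun_add i4), integral_add i3 i4, o1, o2, add_zero, add_zero]

/-- The initial value in terms of mean and covariance. -/
theorem expectedValue_zero (hp0 : 0 ≤ S.p) (hset : IsSetting μ S.p x0 η) (h0 : x 0 = x0) :
    expectedValue μ η x Z X 0 = (∫ ω, x0 ω ∂μ) ⬝ᵥ Z *ᵥ (∫ ω, x0 ω ∂μ)
      + ∫ ω, (x0 ω - ∫ ω, x0 ω ∂μ) ⬝ᵥ S.Psi Z X *ᵥ (x0 ω - ∫ ω, x0 ω ∂μ) ∂μ := by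
  have hg : estimate μ η x 0 =ᵐ[μ] μ[x0 | ⊥ ⊔
      MeasurableSpace.comap (fun ω => received (η 0 ω) (x0 ω)) inferInstance] := by
    rw [estimate, remoteSigma_zero, h0]
  have := integral_quadratic_sup_received (bot_le (a := history x0 η 0)) (hset.history_le 0)
    (hset.measurable_η 0) (hset.indep_history 0)
    ((comap_measurable x0).mono le_sup_left le_rfl) hset.memLp_x0 hp0 (hset.prob_loss 0) Z X hg
  rw [condExp_bot, integral_const, probReal_univ, one_smul] at this
  simp only [expectedValue, estError, h0]
  exact this

omit [IsProbabilityMeasure μ] in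
theorem integral_mulVec {a b : ℕ} {f : Ω → Fin b → ℝ} (hf : Integrable f μ)
    (M : Matrix (Fin a) (Fin b) ℝ) : ∫ ω, M *ᵥ f ω ∂μ = M *ᵥ ∫ ω, f ω ∂μ :=
  (LinearMap.toContinuousLinearMap M.mulVecLin).integral_comp_comm hf

theorem integral_affine_gaussian {g : Ω → ℝ} (hg : MemLp g 2 μ) (hg0 : ∫ ω, g ω ∂μ = 0)
    (v w : Fin n → ℝ) : ∫ ω, (v + g ω • w) ∂μ = v := by
  rw [integral_add (integrable_const v) ((hg.integrable (by norm_num)).smul_const w),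
    integral_smul_const, hg0]
  simp

theorem expectedValue_zero_affine (hp0 : 0 ≤ S.p) {g : Ω → ℝ} {v w : Fin n → ℝ} (hg : MemLp g 2 μ)
    (hg0 : ∫ ω, g ω ∂μ = 0) (hg1 : ∫ ω, g ω ^ 2 ∂μ = 1)
    (hset : IsSetting μ S.p (fun ω => v + g ω • w) η) (h0 : x 0 = fun ω => v + g ω • w) :
    expectedValue μ η x Z X 0 = v ⬝ᵥ Z *ᵥ v + w ⬝ᵥ S.Psi Z X *ᵥ w := by
  rw [expectedValue_zero hp0 hset h0, integral_affine_gaussian hg hg0]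
  congr 1
  have e (ω : Ω) : (v + g ω • w - v) ⬝ᵥ S.Psi Z X *ᵥ (v + g ω • w - v)
      = g ω ^ 2 * (w ⬝ᵥ S.Psi Z X *ᵥ w) := by
    rw [add_sub_cancel_left, mulVec_smul, dotProduct_smul, smul_dotProduct, smul_eq_mul,
      smul_eq_mul]
    ring
  simp_rw [e]
  rw [integral_mul_const, hg1, one_mul]

section Decay

variable {K1 : Matrix (Fin r) (Fin n) ℝ} {K2 L : Matrix (Fin l) (Fin n) ℝ}

/-- The mean of the closed loop follows the certainty-equivalent dynamics. -/
theorem integral_closedLoop (hset : IsSetting μ S.p x0 η) (k : ℕ) :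
    ∫ ω, S.closedLoop μ x0 η K1 K2 L k ω ∂μ
      = (S.A - S.BL * K2 - S.BR * K1) ^ k *ᵥ ∫ ω, x0 ω ∂μ := by
  have hadm := S.isAdmissible_closedLoop μ x0 η K1 K2 L
  have hmem := memLp_closedLoop hset S K1 K2 L
  set x := S.closedLoop μ x0 η K1 K2 L
  induction k with
  | zero => rw [hadm.1.1, pow_zero, one_mulVec]
  | succ k ih =>
    have hm := (hadm.remoteSigma_le_history k).trans (hset.history_le (k + 1))
    have hx := (hmem k).1
    have he : MemLp (estimate μ η x k) 2 μ := hx.condExp (by norm_num)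
    have h1 := hadm.condExp_succ hset (fun k => (hmem k).2.1) (fun k => (hmem k).2.2) k
    have h2 := condExp_localFeedback hm hx K2 L
    have h3 : μ[x (k + 1) | remoteSigma η x k] =ᵐ[μ]
        fun ω => (S.A - S.BL * K2 - S.BR * K1) *ᵥ estimate μ η x k ω := by
      filter_upwards [h1, h2] with ω e1 e2
      rw [e1, e2, remoteFeedback]
      simp only [sub_mulVec, mulVec_neg, mulVec_mulVec]
      abel
    rw [← integral_condExp hm, integral_congr_ae h3, integral_mulVec (he.integrable (by norm_num)),
      estimate, integral_condExp hm, ih, mulVec_mulVec, ← pow_succ']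

/-- Error moments of the closed loop. -/
theorem expectedValue_closedLoop_error (hp0 : 0 ≤ S.p) (hset : IsSetting μ S.p x0 η) (k : ℕ)
    (T : Matrix (Fin n) (Fin n) ℝ) :
    expectedValue μ η (S.closedLoop μ x0 η K1 K2 L) 0 T k = S.p ^ k *
      expectedValue μ η (S.closedLoop μ x0 η K1 K2 L) 0
        (((S.A - S.BL * L) ^ k)ᵀ * T * (S.A - S.BL * L) ^ k) 0 := by
  have hadm := S.isAdmissible_closedLoop μ x0 η K1 K2 L
  have hmem := memLp_closedLoop hset S K1 K2 L
  set x := S.closedLoop μ x0 η K1 K2 L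
  induction k generalizing T with
  | zero => simp
  | succ k ih =>
    have hm := (hadm.remoteSigma_le_history k).trans (hset.history_le (k + 1))
    have hx := (hmem k).1
    have h2 := condExp_localFeedback hm hx K2 L
    have hd : (fun ω => (S.A - S.BL * L) *ᵥ estError μ η x k ω) =ᵐ[μ]
        fun ω => S.A *ᵥ estError μ η x k ω + S.BL *ᵥ (localFeedback μ η K2 L x k ω
          - (μ[localFeedback μ η K2 L x k | remoteSigma η x k]) ω) := by
      filter_upwards [h2] with ω e2
      rw [e2, localFeedback, sub_mulVec, ← mulVec_mulVec, sub_neg_eq_add, sub_eq_add_neg,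
        ← mulVec_neg]
      congr 2
      abel
    -- With `Z = 0` the value measures the error alone, and `Ψ` reduces to `p T`; this is the factor
    -- `p` gained per step.
    rw [hadm.expectedValue_succ_eq hp0 hset (fun k => (hmem k).2.1) (fun k => (hmem k).2.2) k 0 T
      (ae_eq_refl _) hd]
    have e (ω : Ω) : ((S.A - S.BL * L) *ᵥ estError μ η x k ω) ⬝ᵥ
        S.Psi 0 T *ᵥ ((S.A - S.BL * L) *ᵥ estError μ η x k ω)
        = S.p * (estimate μ η x k ω ⬝ᵥ (0 : Matrix (Fin n) (Fin n) ℝ) *ᵥ estimate μ η x k ω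
          + estError μ η x k ω ⬝ᵥ ((S.A - S.BL * L)ᵀ * T * (S.A - S.BL * L)) *ᵥ
            estError μ η x k ω) := by
      rw [Psi, smul_zero, zero_add, smul_mulVec, dotProduct_smul, smul_eq_mul, zero_mulVec,
        dotProduct_zero, zero_add, ← mulVec_mulVec, ← mulVec_mulVec, dotProduct_mulVec_transpose,
        dotProduct_comm]
    simp_rw [e]
    rw [integral_const_mul]
    have hih := ih ((S.A - S.BL * L)ᵀ * T * (S.A - S.BL * L))
    rw [expectedValue] at hih
    simp only [zero_mulVec, dotProduct_zero, integral_zero, zero_add] at hih ⊢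
    rw [hih, ← mul_assoc, ← pow_succ', pow_succ' (S.A - S.BL * L), transpose_mul]
    simp only [Matrix.mul_assoc]

/-- Stabilizing gains have a stable certainty-equivalent loop and an error loop that is stable up to
the packet loss probability. -/
theorem StabilizedBy.tendsto_gains (hp0 : 0 ≤ S.p) (hp1 : S.p ≤ 1)
    (h : S.StabilizedBy K1 K2 L) (v w : Fin n → ℝ) :
    Tendsto (fun k : ℕ => (S.A - S.BL * K2 - S.BR * K1) ^ k *ᵥ v ⬝ᵥ
      (S.A - S.BL * K2 - S.BR * K1) ^ k *ᵥ v) atTop (𝓝 0) ∧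
    Tendsto (fun k : ℕ => S.p ^ k * ((S.A - S.BL * L) ^ k *ᵥ w ⬝ᵥ (S.A - S.BL * L) ^ k *ᵥ w))
      atTop (𝓝 0) := by
  obtain ⟨Ω, _, μ, _, g, η, hg, hg0, hg1, hset⟩ := exists_isSetting hp0 hp1 v w
  have hadm := S.isAdmissible_closedLoop μ (fun ω => v + g ω • w) η K1 K2 L
  have hmem := memLp_closedLoop hset S K1 K2 L
  have hmean := integral_closedLoop (K1 := K1) (K2 := K2) (L := L) hset
  have herr := expectedValue_closedLoop_error (K1 := K1) (K2 := K2) (L := L) hp0 hset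
  have hms : MSTendstoZero μ (S.closedLoop μ (fun ω => v + g ω • w) η K1 K2 L) :=
    h Ω μ _ η hset
  set x := S.closedLoop μ (fun ω => v + g ω • w) η K1 K2 L
  have hx (k : ℕ) : MemLp (x k) 2 μ := (hmem k).1
  have hlim := hms.tendsto_integral hx
  rw [integral_affine_gaussian hg hg0] at hmean
  constructor
  -- The second moment dominates the square of the mean: the orthogonal splitting is used with the
  -- trivial σ-algebra.
  · refine squeeze_zero (fun k => dotProduct_self_nonneg' _) (fun k => ?_) hlim
    have h1 := integral_quadratic_eq_condExp_add_residual
      (bot_le (a := ‹MeasurableSpace Ω›)) (hx k) 1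
    rw [condExp_bot, integral_const, probReal_univ, one_smul, hmean k] at h1
    have h2 := integral_quadratic_nonneg (μ := μ) (PosSemidef.one (n := Fin n) (R := ℝ))
      fun ω => x k ω - (S.A - S.BL * K2 - S.BR * K1) ^ k *ᵥ v
    simp only [one_mulVec] at h1 h2
    linarith
  -- The extra factor `p` comes from the transmission at time zero: the initial error survives only
  -- if that packet is lost.
  · have hle (k : ℕ) : S.p * (S.p ^ k *
        ((S.A - S.BL * L) ^ k *ᵥ w ⬝ᵥ (S.A - S.BL * L) ^ k *ᵥ w)) ≤ ∫ ω, x k ω ⬝ᵥ x k ω ∂μ := by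
      have hm := (hadm.remoteSigma_le_history k).trans (hset.history_le (k + 1))
      have h1 := integral_quadratic_eq_condExp_add_residual hm (hx k) 1
      have h2 := integral_quadratic_nonneg (μ := μ) (PosSemidef.one (n := Fin n) (R := ℝ))
        (μ[x k | remoteSigma η x k])
      have h3 := herr k 1
      rw [expectedValue_zero_affine hp0 hg hg0 hg1 hset hadm.1.1] at h3
      have h4 : w ⬝ᵥ S.Psi 0 (((S.A - S.BL * L) ^ k)ᵀ * 1 * (S.A - S.BL * L) ^ k) *ᵥ w
          = S.p * ((S.A - S.BL * L) ^ k *ᵥ w ⬝ᵥ (S.A - S.BL * L) ^ k *ᵥ w) := by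
        rw [Psi, smul_zero, zero_add, smul_mulVec, dotProduct_smul, smul_eq_mul, Matrix.mul_one,
          ← mulVec_mulVec, dotProduct_mulVec_transpose]
      rw [h4] at h3
      simp only [expectedValue, one_mulVec, zero_mulVec, dotProduct_zero, zero_add,
        estError, estimate] at h1 h2 h3
      rw [h1, h3]
      linarith
    -- For `p = 0` the bound carries no information, but then `p ^ k` vanishes for `k > 0`.
    rcases hp0.eq_or_lt with hp | hp
    · refine tendsto_const_nhds.congr' ?_
      filter_upwards [eventually_gt_atTop 0] with k hk
      rw [← hp, zero_pow hk.ne', zero_mul]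
    · have h1 : Tendsto (fun k : ℕ => S.p * (S.p ^ k *
          ((S.A - S.BL * L) ^ k *ᵥ w ⬝ᵥ (S.A - S.BL * L) ^ k *ᵥ w))) atTop (𝓝 0) :=
        squeeze_zero (fun k => mul_nonneg hp0 (mul_nonneg (pow_nonneg hp0 k)
          (dotProduct_self_nonneg' _))) hle hlim
      have h2 := h1.const_mul S.p⁻¹
      simpa [inv_mul_cancel_left₀ hp.ne'] using h2

end Decay

/-- A solution of the coupled Riccati equations has a positive semi-definite error weight. -/
theorem IsRiccatiSolution.posSemidef_X (h : S.IsRiccatiSolution Z X) (hRL : S.RL.PosDef)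
    (hQ : S.Q.PosSemidef) : X.PosSemidef := by
  have h1 : X = riccatiMap S.A S.BL S.Q S.RL (S.Psi Z X) := h.eq_X
  rw [h1]
  exact riccatiMap_posSemidef hRL hQ h.posDef_Psi.posSemidef

theorem IsRiccatiSolution.eq_Z' (h : S.IsRiccatiSolution Z X) (hRL : S.RL.PosDef)
    (hRR : S.RR.PosDef) : Z = riccatiMap S.A S.B S.Q S.blockR Z :=
  h.eq_Z.trans (riccatiMap_Z hRL hRR h.posDef_Z.posSemidef)

/-- Optimality of the stationary controls. -/
theorem IsRiccatiSolution.optimal (h : S.IsRiccatiSolution Z X) (hp0 : 0 ≤ S.p)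
    (hRL : S.RL.PosDef) (hRR : S.RR.PosDef) (hQ : S.Q.PosSemidef)
    (hobs : Observable S.A (CFC.sqrt S.Q)) (hset : IsSetting μ S.p x0 η)
    (hx : x = S.closedLoop μ x0 η (S.remoteGain Z) (S.localGain Z) (S.errorGain Z X)) :
    S.cost μ (localFeedback μ η (S.localGain Z) (S.errorGain Z X) x)
        (remoteFeedback μ η (S.remoteGain Z) x) x = ENNReal.ofReal (initialValue μ x0 η Z X) ∧
      ∀ (vL : ℕ → Ω → Fin l → ℝ) (vR : ℕ → Ω → Fin r → ℝ) (x' : ℕ → Ω → Fin n → ℝ),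
        S.IsAdmissible x0 η vL vR x' →
        ENNReal.ofReal (initialValue μ x0 η Z X) ≤ S.cost μ vL vR x' := by
  have hZ := h.posDef_Z.posSemidef
  have hX := h.posSemidef_X hRL hQ
  have hΨ := h.posDef_Psi.posSemidef
  have hfZ := h.eq_Z' hRL hRR
  have hfX : X = riccatiMap S.A S.BL S.Q S.RL (S.Psi Z X) := h.eq_X
  have hadm := S.isAdmissible_closedLoop μ x0 η (S.remoteGain Z) (S.localGain Z) (S.errorGain Z X)
  rw [← hx] at hadm
  have hlow (vL : ℕ → Ω → Fin l → ℝ) (vR : ℕ → Ω → Fin r → ℝ) (x' : ℕ → Ω → Fin n → ℝ)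
      (ha : S.IsAdmissible x0 η vL vR x') :
      ENNReal.ofReal (initialValue μ x0 η Z X) ≤ S.cost μ vL vR x' := by
    rw [initialValue_eq_expectedValue hset ha.1.1]
    exact ha.expectedValue_le_cost hp0 hset hRL hRR hQ hobs hZ hX hΨ hfZ hfX
  refine ⟨le_antisymm ?_ (hlow _ _ _ hadm), hlow⟩
  rw [initialValue_eq_expectedValue hset hadm.1.1]
  exact cost_closedLoop_le hp0 hset hRL hRR hQ hZ hX hΨ hfZ hfX hx

/-- Stability comes from optimality: the stationary controls have finite cost, and finite cost with
observability forces the state to zero. -/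
theorem IsRiccatiSolution.stabilizedBy (h : S.IsRiccatiSolution Z X) (hp0 : 0 ≤ S.p)
    (hRL : S.RL.PosDef) (hRR : S.RR.PosDef) (hQ : S.Q.PosSemidef)
    (hobs : Observable S.A (CFC.sqrt S.Q)) :
    S.StabilizedBy (S.remoteGain Z) (S.localGain Z) (S.errorGain Z X) := by
  intro Ω _ μ _ x0 η hset
  have hadm := S.isAdmissible_closedLoop μ x0 η (S.remoteGain Z) (S.localGain Z) (S.errorGain Z X)
  refine (hadm.of_cost_ne_top hset hRL hRR hQ hobs ?_).2.2
  rw [(h.optimal hp0 hRL hRR hQ hobs hset rfl).1]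
  exact ENNReal.ofReal_ne_top

theorem eq_of_quadratic_eq {P T : Matrix (Fin n) (Fin n) ℝ} (hP : P.IsHermitian)
    (hT : T.IsHermitian) (h : ∀ v : Fin n → ℝ, v ⬝ᵥ P *ᵥ v = v ⬝ᵥ T *ᵥ v) : P = T := by
  have hle : P ≤ T := by
    refine PosSemidef.of_dotProduct_mulVec_nonneg (hT.sub hP) fun v => ?_
    simp [sub_mulVec, dotProduct_sub, h]
  have hge : T ≤ P := by
    refine PosSemidef.of_dotProduct_mulVec_nonneg (hP.sub hT) fun v => ?_
    simp [sub_mulVec, dotProduct_sub, h]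
  exact le_antisymm hle hge

/-- The optimal cost determines the solution of the coupled Riccati equations. -/
theorem IsRiccatiSolution.unique {Z₁ X₁ Z₂ X₂ : Matrix (Fin n) (Fin n) ℝ}
    (h₁ : S.IsRiccatiSolution Z₁ X₁) (h₂ : S.IsRiccatiSolution Z₂ X₂) (hp0 : 0 ≤ S.p)
    (hp1 : S.p ≤ 1) (hRL : S.RL.PosDef) (hRR : S.RR.PosDef) (hQ : S.Q.PosSemidef)
    (hobs : Observable S.A (CFC.sqrt S.Q)) : Z₁ = Z₂ ∧ X₁ = X₂ := by
  have key (v w : Fin n → ℝ) : v ⬝ᵥ Z₁ *ᵥ v + w ⬝ᵥ S.Psi Z₁ X₁ *ᵥ w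
      = v ⬝ᵥ Z₂ *ᵥ v + w ⬝ᵥ S.Psi Z₂ X₂ *ᵥ w := by
    obtain ⟨Ω, _, μ, _, g, η, hg, hg0, hg1, hset⟩ := exists_isSetting hp0 hp1 v w
    have value (Z X : Matrix (Fin n) (Fin n) ℝ) :
        initialValue μ (fun ω => v + g ω • w) η Z X = v ⬝ᵥ Z *ᵥ v + w ⬝ᵥ S.Psi Z X *ᵥ w := by
      rw [initialValue_eq_expectedValue (x := fun _ => fun ω => v + g ω • w) hset rfl,
        expectedValue_zero_affine hp0 hg hg0 hg1 hset rfl]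
    have o₁ := h₁.optimal hp0 hRL hRR hQ hobs hset rfl
    have o₂ := h₂.optimal hp0 hRL hRR hQ hobs hset rfl
    have a₁ := S.isAdmissible_closedLoop μ (fun ω => v + g ω • w) η (S.remoteGain Z₁)
      (S.localGain Z₁) (S.errorGain Z₁ X₁)
    have a₂ := S.isAdmissible_closedLoop μ (fun ω => v + g ω • w) η (S.remoteGain Z₂)
      (S.localGain Z₂) (S.errorGain Z₂ X₂)
    have e := le_antisymm ((o₁.2 _ _ _ a₂).trans_eq o₂.1) ((o₂.2 _ _ _ a₁).trans_eq o₁.1)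
    -- Equality of the optimal costs gives equality of the real values because both are nonnegative,
    -- which is part of being a solution.
    rw [ENNReal.ofReal_eq_ofReal_iff (h₁.nonneg _ _ _ _ hset) (h₂.nonneg _ _ _ _ hset)] at e
    rw [← value, ← value, e]
  have hZ : Z₁ = Z₂ := eq_of_quadratic_eq h₁.posDef_Z.isHermitian h₂.posDef_Z.isHermitian
    fun v => by simpa using key v 0
  have hΨ : S.Psi Z₁ X₁ = S.Psi Z₂ X₂ :=
    eq_of_quadratic_eq h₁.posDef_Psi.isHermitian h₂.posDef_Psi.isHermitian fun w => by
      simpa using key 0 w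
  refine ⟨hZ, ?_⟩
  -- `X` is recovered through its equation and not by inverting the definition of `Ψ`, so `p = 0`
  -- needs no separate case.
  have e₁ : X₁ = riccatiMap S.A S.BL S.Q S.RL (S.Psi Z₁ X₁) := h₁.eq_X
  have e₂ : X₂ = riccatiMap S.A S.BL S.Q S.RL (S.Psi Z₂ X₂) := h₂.eq_X
  rw [e₁, e₂, hΨ]

/-- Stabilizability yields a solution of the coupled Riccati equations. -/
theorem MeanSquareStabilizable.exists_isRiccatiSolution (h : S.MeanSquareStabilizable)
    (hp0 : 0 ≤ S.p) (hp1 : S.p ≤ 1) (hRL : S.RL.PosDef) (hRR : S.RR.PosDef) (hQ : S.Q.PosSemidef)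
    (hobs : Observable S.A (CFC.sqrt S.Q)) :
    ∃ Z X : Matrix (Fin n) (Fin n) ℝ, S.IsRiccatiSolution Z X := by
  obtain ⟨K1, K2, L, hst⟩ := h
  have hR := posDef_blockR hRL hRR
  have hF : S.A - S.B * fromRows K2 K1 = S.A - S.BL * K2 - S.BR * K1 := by
    rw [B, fromCols_mul_fromRows, sub_sub]
  -- `W = 0` and discount `1` give the standard equation for `Z`. The equation for `X` is solved
  -- next, with `W = (1 - p) Z` and discount `p`.
  obtain ⟨Z, hZ, hfZ⟩ := exists_riccati_fixedPoint (A := S.A) (B := S.B) hQ hR PosSemidef.zero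
    zero_le_one (fromRows K2 K1) fun v => by
      simpa [hF] using (hst.tendsto_gains hp0 hp1 v 0).1
  rw [one_smul, zero_add] at hfZ
  have hZd := posDef_of_riccati_fixedPoint hQ hR hZ hfZ hobs
  have hW : ((1 - S.p) • Z).PosSemidef := hZ.smul (sub_nonneg.mpr hp1)
  obtain ⟨X, hX, hfX⟩ := exists_riccati_fixedPoint (A := S.A) (B := S.BL) hQ hRL hW hp0 L
    fun v => (hst.tendsto_gains hp0 hp1 0 v).2
  have hΨ : (S.Psi Z X).PosDef := by
    -- For `p = 1` the weight `Ψ` is `X`, which solves a standard Riccati equation in `BL` and is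
    -- definite by observability. For `p < 1` the part `(1 - p) Z` is already definite.
    rcases hp1.eq_or_lt with hp | hp
    · rw [hp, sub_self, zero_smul, zero_add, one_smul] at hfX
      have := posDef_of_riccati_fixedPoint hQ hRL hX hfX hobs
      rwa [Psi, hp, sub_self, zero_smul, zero_add, one_smul]
    · exact (hZd.smul (sub_pos.mpr hp)).add_posSemidef (hX.smul hp0)
  refine ⟨Z, X, hfZ.trans (riccatiMap_Z hRL hRR hZ).symm, hfX, hZd, hΨ, ?_⟩
  intro Ω _ μ _ x0 η hset
  rw [initialValue_eq_expectedValue (x := fun _ => x0) hset rfl]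
  exact expectedValue_nonneg hZ hX 0

end NCS

/-! ### The main theorem -/

theorem theorem2 {n l r m : ℕ} (S : NCS n l r)
    (hp0 : 0 ≤ S.p) (hp1 : S.p ≤ 1)
    (hRL : S.RL.PosDef) (hRR : S.RR.PosDef)
    (C : Matrix (Fin m) (Fin n) ℝ) (hQ : S.Q = Cᵀ * C)
    (hobs : Observable S.A (CFC.sqrt S.Q)) :
    (S.MeanSquareStabilizable ↔
      ∃! ZX : Matrix (Fin n) (Fin n) ℝ × Matrix (Fin n) (Fin n) ℝ,
        S.IsRiccatiSolution ZX.1 ZX.2) ∧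
    ∀ Z X : Matrix (Fin n) (Fin n) ℝ, S.IsRiccatiSolution Z X →
      S.StabilizedBy (S.remoteGain Z) (S.localGain Z) (S.errorGain Z X) ∧
      ∀ (Ω : Type) [MeasurableSpace Ω] (μ : Measure Ω) [IsProbabilityMeasure μ]
        (x0 : Ω → Fin n → ℝ) (η : ℕ → Ω → Bool), IsSetting μ S.p x0 η →
        ∀ x : ℕ → Ω → Fin n → ℝ,
          x = S.closedLoop μ x0 η (S.remoteGain Z) (S.localGain Z) (S.errorGain Z X) →
        ∀ (uL : ℕ → Ω → Fin l → ℝ) (uR : ℕ → Ω → Fin r → ℝ),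
          uL = localFeedback μ η (S.localGain Z) (S.errorGain Z X) x →
          uR = remoteFeedback μ η (S.remoteGain Z) x →
          S.IsAdmissible x0 η uL uR x ∧
          S.cost μ uL uR x = ENNReal.ofReal (NCS.initialValue μ x0 η Z X) ∧
          ∀ (vL : ℕ → Ω → Fin l → ℝ) (vR : ℕ → Ω → Fin r → ℝ) (x' : ℕ → Ω → Fin n → ℝ),
            S.IsAdmissible x0 η vL vR x' →
            S.cost μ uL uR x ≤ S.cost μ vL vR x' := by
  have hQ' : S.Q.PosSemidef := by
    rw [hQ]; simpa using posSemidef_conjTranspose_mul_self C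
  refine ⟨⟨fun h => ?_, ?_⟩, fun Z X h => ⟨h.stabilizedBy hp0 hRL hRR hQ' hobs, ?_⟩⟩
  · obtain ⟨Z, X, hs⟩ := h.exists_isRiccatiSolution hp0 hp1 hRL hRR hQ' hobs
    refine ⟨(Z, X), hs, fun ZX hZX => ?_⟩
    obtain ⟨h1, h2⟩ := NCS.IsRiccatiSolution.unique hZX hs hp0 hp1 hRL hRR hQ' hobs
    exact Prod.ext h1 h2
  · rintro ⟨ZX, hs, -⟩
    exact ⟨_, _, _, NCS.IsRiccatiSolution.stabilizedBy hs hp0 hRL hRR hQ' hobs⟩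
  · rintro Ω _ μ _ x0 η hset x hx uL uR rfl rfl
    obtain ⟨hcost, hlow⟩ := h.optimal hp0 hRL hRR hQ' hobs hset hx
    refine ⟨?_, hcost, fun vL vR x' ha => hcost.trans_le (hlow vL vR x' ha)⟩
    rw [hx]
    exact S.isAdmissible_closedLoop μ x0 η _ _ _
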